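/- Let $d\ge 2$, $0<\mu_1<\dots<\mu_d$ and $\rho>0$. For $\theta=(w^{(1)},w^{(2)})\in\mathbb R^d\times\mathbb R^d$ put $\beta_j=w^{(1)}_jw^{(2)}_j$ and $L(\theta)=\log\bigl(1+e^{-\langle\beta,\mu\rangle}\bigr)$. For $\alpha>0$ consider the SAM flow $$\dot\theta=-\nabla L\Bigl(\theta+\rho\,\frac{\nabla L(\theta)}{\|\nabla L(\theta)\|_2}\Bigr),\qquad w^{(1)}(0)=w^{(2)}(0)=\alpha\mathbf 1,$$ on an interval $[0,T)$, $0<T\le\infty$, along which $\nabla L(\theta)\neq0$; a solution is maximal if it cannot be extended to a longer such interval. Along a solution let $$m_c=\frac1{2\rho}\Bigl(\sum_j\mu_j^2\bigl((w_j^{(1)})^2+(w_j^{(2)})^2\bigr)\Bigr)^{1/2},\quad p_j=\frac{\mu_j^2\beta_j}{\sum_k\mu_k^2\beta_k},\quad M_r=\sum_j\mu_j^rp_j,\quad m_H=\frac{M_2}{2M_1},\quad m_L=\frac{\mu_1}2,$$ and let $\tau_F=\inf\{t\in[0,T):m_c(t)=m_L\}$ and $\tau_G=\inf\{t\in[0,T):m_c(t)=m_H(t)\}$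 in $[0,\infty]$, with $\inf\emptyset=\infty$. Put $$\alpha_0=\frac{\rho\,\mu_1}{\sqrt2\,\|\mu\|_2},\qquad \alpha_H=\frac{\rho\,\|\mu\|_4^4}{\sqrt2\,\|\mu\|_2\,\|\mu\|_3^3},\qquad \alpha_2=\frac{\rho\,(\mu_{d-1}+\mu_d)}{\sqrt2\,\|\mu\|_2}.$$ Say that a function decays exponentially on an interval $I$ if it is positive on $I$ and there is $c>0$ with $f(t)\le f(s)e^{-c(t-s)}$ for all $s\le t$ in $I$. For every $\alpha>0$ a maximal solution exists, and the following holds for every maximal solution. 1. (Regime 1-a) If $0<\alpha<\alpha_0$, then on $[0,T)$ one has $m_c(t)<m_L$, $m_c$ is strictly decreasing, and every $\beta_j$ decays exponentially. 2. There is $\alpha_1$ with $\alpha_0<\alpha_1<\alpha_H<\alpha_2$ such that: - (boundary trajectory) for $\alpha=\alpha_1$, $T=\infty$ and $m_L<m_c(t)<m_H(t)$ for all $t\ge0$; and $\alpha_1$ is unique: if for some $\alpha>0$ one has $m_L<m_c(t)<m_H(t)$ for all $t\in[0,T)$, then $\alpha=\alpha_1$; - (Regime 1-b, floor first) if $\alpha_0\le\alpha<\alpha_1$,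 then $\tau_F<\tau_G$, $m_c$ is strictly decreasing on $[0,T)$, $\tau_F<T$ is attained, and for every $t_0\in(\tau_F,T)$ one has $m_c(t_0)<m_L$ and every $\beta_j$ decays exponentially on $[t_0,T)$; - (Regime 2-a, ceiling first) if $\alpha_1<\alpha\le\alpha_H$, then $T=\infty$, $\tau_G<\tau_F$ (so $\tau_G<\infty$), $m_c$ is strictly decreasing on $[0,\tau_G]$ and strictly increasing on $[\tau_G,\infty)$, and $m_c(t)>m_H(t)$ for all $t>\tau_G$. 3. (Regimes 2-b and 3) If $\alpha>\alpha_H$, then $T=\infty$, $m_c(t)>m_H(t)$ for all $t\ge0$, and $m_c$ is strictly increasing on $[0,\infty)$. Moreover, for every $\alpha>0$, $\alpha<\alpha_2$ if and only if $m_c(0)<(\mu_{d-1}+\mu_d)/2$, and $\alpha>\alpha_2$ if and only if $m_c(0)>(\mu_{d-1}+\mu_d)/2$; if $\alpha>\alpha_2$, then $m_c(t)>(\mu_{d-1}+\mu_d)/2$ for all $t\ge0$. -/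

import Mathlib

open scoped Gradient

noncomputable section

namespace SAMFlow

/-- Parameters of the depth-2 diagonal linear network with `d` features:
`θ (0, j)` is the `j`-th weight of the first layer, `θ (1, j)` that of the second. -/
abbrev Params (d : ℕ) : Type := EuclideanSpace ℝ (Fin 2 × Fin d)

/-- The effective coefficient `β_j`. -/
def beta {d : ℕ} (θ : Params d) (j : Fin d) : ℝ := θ (0, j) * θ (1, j)

/-- The margin `⟨β, μ⟩`. -/
def margin {d : ℕ} (μ : Fin d → ℝ) (θ : Params d) : ℝ := ∑ j, beta θ j * μ j

/-- The logistic loss of a margin. -/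
def logistic (s : ℝ) : ℝ := Real.log (1 + Real.exp (-s))

/-- The training loss. -/
def loss {d : ℕ} (μ : Fin d → ℝ) (θ : Params d) : ℝ := logistic (margin μ θ)

/-- The perturbed parameter: a step of length `ρ` along the normalized gradient. -/
def perturbed {d : ℕ} (μ : Fin d → ℝ) (ρ : ℝ) (θ : Params d) : Params d :=
  θ + (ρ / ‖∇ (loss μ) θ‖) • ∇ (loss μ) θ

/-- The time interval `[0, T)`, where `T` may be infinite. -/
def lifespan (T : EReal) : Set ℝ := {t : ℝ | 0 ≤ t ∧ (t : EReal) < T}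

/-- `θ` solves the SAM flow `θ' = -∇ L (θ + ρ ∇ L(θ) / ‖∇ L(θ)‖)` on `[0, T)`, starting with all
weights equal to `α`. The normalized gradient has to be defined along the solution. -/
structure IsFlow {d : ℕ} (μ : Fin d → ℝ) (ρ α : ℝ) (T : EReal) (θ : ℝ → Params d) : Prop where
  pos : 0 < T
  init : ∀ i, θ 0 i = α
  grad_ne_zero : ∀ t ∈ lifespan T, ∇ (loss μ) (θ t) ≠ 0
  deriv : ∀ t ∈ lifespan T,
    HasDerivWithinAt θ (-∇ (loss μ) (perturbed μ ρ (θ t))) (Set.Ici 0) t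

/-- A solution of the SAM flow that has no extension to a longer interval. -/
structure IsMaximalFlow {d : ℕ} (μ : Fin d → ℝ) (ρ α : ℝ) (T : EReal) (θ : ℝ → Params d) : Prop
    extends IsFlow μ ρ α T θ where
  maximal : ∀ (T' : EReal) (θ' : ℝ → Params d), IsFlow μ ρ α T' θ' →
    (∀ t ∈ lifespan T, θ' t = θ t) → T' ≤ T

/-- `n_θ`, the square root of `∑ μ_j² ((w⁽¹⁾_j)² + (w⁽²⁾_j)²)`. -/
def nTheta {d : ℕ} (μ : Fin d → ℝ) (θ : Params d) : ℝ :=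
  Real.sqrt (∑ j, μ j ^ 2 * (θ (0, j) ^ 2 + θ (1, j) ^ 2))

/-- The center `m_c = n_θ / (2 ρ)`. -/
def mc {d : ℕ} (μ : Fin d → ℝ) (ρ : ℝ) (θ : Params d) : ℝ := nTheta μ θ / (2 * ρ)

/-- The normalized weights `p_j`. -/
def prop {d : ℕ} (μ : Fin d → ℝ) (θ : Params d) (j : Fin d) : ℝ :=
  μ j ^ 2 * beta θ j / ∑ k, μ k ^ 2 * beta θ k

/-- The moments `M_r = ∑ μ_j^r p_j`. -/
def moment {d : ℕ} (μ : Fin d → ℝ) (r : ℕ) (θ : Params d) : ℝ := ∑ j, μ j ^ r * prop μ θ j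

/-- The ceiling `m_H = M₂ / (2 M₁)`. -/
def mH {d : ℕ} (μ : Fin d → ℝ) (θ : Params d) : ℝ := moment μ 2 θ / (2 * moment μ 1 θ)

/-- The floor `m_L = μ₁ / 2`. -/
def mL {k : ℕ} (μ : Fin (k + 2) → ℝ) : ℝ := μ 0 / 2

/-- The midpoint `(μ_{d-1} + μ_d) / 2` of the two largest features, `d = k + 2`. -/
def mTop {k : ℕ} (μ : Fin (k + 2) → ℝ) : ℝ :=
  (μ (Fin.last k).castSucc + μ (Fin.last (k + 1))) / 2

/-- The first time in `[0, T)` at which `P` holds; `⊤` if there is none. -/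
def hittingTime (T : EReal) (P : ℝ → Prop) : EReal :=
  sInf ((fun t : ℝ => (t : EReal)) '' {t | t ∈ lifespan T ∧ P t})

/-- The floor hitting time `τ_F`. -/
def tauF {k : ℕ} (μ : Fin (k + 2) → ℝ) (ρ : ℝ) (T : EReal) (θ : ℝ → Params (k + 2)) : EReal :=
  hittingTime T fun t => mc μ ρ (θ t) = mL μ

/-- The ceiling hitting time `τ_G`. -/
def tauG {d : ℕ} (μ : Fin d → ℝ) (ρ : ℝ) (T : EReal) (θ : ℝ → Params d) : EReal :=
  hittingTime T fun t => mc μ ρ (θ t) - mH μ (θ t) = 0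

/-- `f` is positive and decays exponentially on `I`, at some rate `c > 0` between any two times. -/
def ExpDecayOn (f : ℝ → ℝ) (I : Set ℝ) : Prop :=
  (∀ t ∈ I, 0 < f t) ∧
    ∃ c : ℝ, 0 < c ∧ ∀ s ∈ I, ∀ t ∈ I, s ≤ t → f t ≤ f s * Real.exp (-c * (t - s))

/-- `‖μ‖₂` -/
def norm2 {d : ℕ} (μ : Fin d → ℝ) : ℝ := Real.sqrt (∑ j, μ j ^ 2)

/-- `α₀ = ρ μ₁ / (√2 ‖μ‖₂)` -/
def alpha0 {k : ℕ} (μ : Fin (k + 2) → ℝ) (ρ : ℝ) : ℝ := ρ * μ 0 / (Real.sqrt 2 * norm2 μ)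

/-- `α_H = ρ ‖μ‖₄⁴ / (√2 ‖μ‖₂ ‖μ‖₃³)`; the features are positive. -/
def alphaH {d : ℕ} (μ : Fin d → ℝ) (ρ : ℝ) : ℝ :=
  ρ * (∑ j, μ j ^ 4) / (Real.sqrt 2 * norm2 μ * ∑ j, μ j ^ 3)

/-- `α₂ = ρ (μ_{d-1} + μ_d) / (√2 ‖μ‖₂)`, `d = k + 2`. -/
def alpha2 {k : ℕ} (μ : Fin (k + 2) → ℝ) (ρ : ℝ) : ℝ :=
  ρ * (μ (Fin.last k).castSucc + μ (Fin.last (k + 1))) / (Real.sqrt 2 * norm2 μ)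

end SAMFlow

end

/-! In each coordinate the sum and the difference of the two layers solve homogeneous linear
equations, so the layers stay equal and positive. Writing the weights as e^{y_j}, the flow becomes
y_j' = g μ_j (1 - μ_j r), where r = 1/(2 m_c) and 0 < g < 1 is the logistic factor at the perturbed
point.

With A_n = ∑ μ_j^n β_j one has A_2 = 2ρ² m_c², m_H = A_4/(2 A_3) and m_c' = g (A_3/A_2)(m_c - m_H).
Two one-way barriers follow. Where m_c = m_H the center is stationary while the ceiling strictly
decreases, by a sum-of-squares identity (`logCeiling_deriv_neg`), so m_c - m_H can cross zero only
upwards. Since m_L < m_H, the floor can be crossed only downwards. Hence a trajectory falls below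
the floor, or rises above the ceiling, or stays strictly between them, and these cases exclude each
other.

A finite lifespan forces m_c to come arbitrarily close to 0: with r cut off the field is bounded and
locally Lipschitz (`IsMaximalSolution.eq_top_of_le_logCenter`). Falling and rising are open
conditions on α (`IsMaximalSolution.eventually_mem`); the first holds for α ≤ α₀, the second for α ≥
α_H, so by connectedness some scale is trapped.

Its uniqueness is `not_lt_of_trapped`. In the clock s = ∫ g one has y_j = log α + μ_j s - μ_j² R.
Take two trapped solutions with α < α' and l = log(α'/α). If R = R' at equal s, the lower solution
has the smaller center, hence the larger dR/ds = r; so R ≥ R' persists and y_j ≤ y'_j - l. The floor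
bound for the lower solution then keeps the upper center at least e^l m_L, so the upper y'_0 grows
linearly, although its center is bounded. -/

namespace SAMFlow

open Set Filter Topology Metric
open scoped Gradient NNReal

/-! ### Time intervals with a possibly infinite end. -/

section Lifespan

theorem lifespan_mono {T T' : EReal} (h : T ≤ T') : lifespan T ⊆ lifespan T' :=
  fun _ ht => ⟨ht.1, ht.2.trans_le h⟩

theorem lifespan_subset_Ici (T : EReal) : lifespan T ⊆ Ici 0 := fun _ ht => ht.1

theorem zero_mem_lifespan {T : EReal} (h : 0 < T) : (0 : ℝ) ∈ lifespan T :=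
  ⟨le_rfl, by simpa using h⟩

theorem mem_lifespan_coe {t b : ℝ} : t ∈ lifespan (b : EReal) ↔ 0 ≤ t ∧ t < b := by
  simp [lifespan]

theorem mem_lifespan_top {t : ℝ} : t ∈ lifespan ⊤ ↔ 0 ≤ t := by
  simp [lifespan]

theorem mem_lifespan_of_le {T : EReal} {s t : ℝ} (hs : 0 ≤ s) (hst : s ≤ t)
    (ht : t ∈ lifespan T) : s ∈ lifespan T :=
  ⟨hs, lt_of_le_of_lt (by exact_mod_cast hst) ht.2⟩

theorem convex_lifespan (T : EReal) : Convex ℝ (lifespan T) := by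
  refine OrdConnected.convex ⟨fun x hx y hy z hz => ?_⟩
  exact mem_lifespan_of_le (hx.1.trans hz.1) hz.2 hy

theorem exists_lt_mem_lifespan {T : EReal} {t : ℝ} (ht : t ∈ lifespan T) :
    ∃ t' ∈ lifespan T, t < t' := by
  obtain ⟨q, hq1, hq2⟩ := EReal.lt_iff_exists_real_btwn.1 ht.2
  have : t < q := by exact_mod_cast hq1
  exact ⟨q, ⟨ht.1.trans this.le, hq2⟩, this⟩

theorem interior_subset_Ioi {I : Set ℝ} (hI : I ⊆ Ici 0) : interior I ⊆ Ioi 0 := by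
  simpa using interior_mono hI

end Lifespan

/-! ### Monotonicity, one-way barriers and inverse functions. -/

section Calculus

theorem strictMonoOn_of_hasDerivWithinAt_pos {I : Set ℝ} (hI : Convex ℝ I) (hI0 : I ⊆ Ici 0)
    {f f' : ℝ → ℝ} (hf : ∀ t ∈ I, HasDerivWithinAt f (f' t) (Ici 0) t)
    (hpos : ∀ t ∈ interior I, 0 < f' t) : StrictMonoOn f I := by
  refine strictMonoOn_of_deriv_pos hI
    (fun t ht => (hf t ht).continuousWithinAt.mono hI0) fun t ht => ?_
  rw [((hf t (interior_subset ht)).hasDerivAt (Ici_mem_nhds (interior_subset_Ioi hI0 ht))).deriv]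
  exact hpos t ht

theorem strictAntiOn_of_hasDerivWithinAt_neg {I : Set ℝ} (hI : Convex ℝ I) (hI0 : I ⊆ Ici 0)
    {f f' : ℝ → ℝ} (hf : ∀ t ∈ I, HasDerivWithinAt f (f' t) (Ici 0) t)
    (hneg : ∀ t ∈ interior I, f' t < 0) : StrictAntiOn f I := by
  refine strictAntiOn_of_deriv_neg hI
    (fun t ht => (hf t ht).continuousWithinAt.mono hI0) fun t ht => ?_
  rw [((hf t (interior_subset ht)).hasDerivAt (Ici_mem_nhds (interior_subset_Ioi hI0 ht))).deriv]
  exact hneg t ht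

theorem monotoneOn_of_hasDerivWithinAt_nonneg {I : Set ℝ} (hI : Convex ℝ I) (hI0 : I ⊆ Ici 0)
    {f f' : ℝ → ℝ} (hf : ∀ t ∈ I, HasDerivWithinAt f (f' t) (Ici 0) t)
    (hpos : ∀ t ∈ I, 0 ≤ f' t) : MonotoneOn f I := by
  have hd : ∀ t ∈ interior I, HasDerivAt f (f' t) t := fun t ht =>
    (hf t (interior_subset ht)).hasDerivAt (Ici_mem_nhds (interior_subset_Ioi hI0 ht))
  refine monotoneOn_of_deriv_nonneg hI (fun t ht => (hf t ht).continuousWithinAt.mono hI0)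
    (fun t ht => (hd t ht).differentiableAt.differentiableWithinAt) fun t ht => ?_
  rw [(hd t ht).deriv]
  exact hpos t (interior_subset ht)

/-- A function whose derivative is positive at each of its zeros stays positive once it is
nonnegative. -/
theorem pos_of_nonneg_of_deriv_pos_of_eq_zero {T : EReal} {f f' : ℝ → ℝ}
    (hf : ∀ t ∈ lifespan T, HasDerivWithinAt f (f' t) (Ici 0) t)
    (hcross : ∀ t ∈ lifespan T, f t = 0 → 0 < f' t) {t₀ t : ℝ} (ht₀ : 0 ≤ t₀)
    (h₀ : 0 ≤ f t₀) (ht : t ∈ lifespan T) (hlt : t₀ < t) : 0 < f t := by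
  have hmem : ∀ x ∈ Icc t₀ t, x ∈ lifespan T := fun x hx =>
    mem_lifespan_of_le (ht₀.trans hx.1) hx.2 ht
  have hnn : ∀ ⦃x⦄, x ∈ Icc t₀ t → (fun _ => (0 : ℝ)) x ≤ f x := by
    refine image_le_of_deriv_right_lt_deriv_boundary' (f' := fun _ => 0) (B' := f')
      continuousOn_const (fun x _ => hasDerivWithinAt_const _ _ _) h₀ ?_ ?_ ?_
    · exact fun x hx => (hf x (hmem x hx)).continuousWithinAt.mono fun z hz => ht₀.trans hz.1
    · exact fun x hx => (hf x (hmem x (Ico_subset_Icc_self hx))).mono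
        fun z hz => (ht₀.trans hx.1).trans hz
    · exact fun x hx h => hcross x (hmem x (Ico_subset_Icc_self hx)) h.symm
  -- The comparison gives only f ≥ 0. A zero at t with positive derivative would make f negative
  -- just to the left of t.
  refine lt_of_le_of_ne (hnn ⟨hlt.le, le_rfl⟩) fun h => ?_
  have hpos := hcross t ht h.symm
  have hd : HasDerivAt f (f' t) t :=
    (hf t ht).hasDerivAt (Ici_mem_nhds (ht₀.trans_lt hlt))
  have hs := (hasDerivAt_iff_tendsto_slope_left_right.1 hd).1
  have h1 : ∀ᶠ x in 𝓝[<] t, 0 < slope f t x := hs.eventually (lt_mem_nhds hpos)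
  have h2 : ∀ᶠ x in 𝓝[<] t, x ∈ Ioo t₀ t := Ioo_mem_nhdsLT hlt
  obtain ⟨x, hx1, hx2⟩ := (h1.and h2).exists
  rw [slope_def_field, ← h] at hx1
  have : 0 ≤ f x := hnn ⟨hx2.1.le, hx2.2.le⟩
  have h3 : (f x - 0) / (x - t) ≤ 0 :=
    div_nonpos_of_nonneg_of_nonpos (by linarith) (by linarith [hx2.2])
  linarith

/-- A function on `[0, ∞)` that vanishes at `0` and has derivative at least `c > 0` has a
differentiable inverse. -/
theorem exists_inverse_of_deriv_ge {s s' : ℝ → ℝ} {c : ℝ} (hc : 0 < c) (h0 : s 0 = 0)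
    (hs : ∀ t, 0 ≤ t → HasDerivWithinAt s (s' t) (Ici 0) t) (hge : ∀ t, 0 ≤ t → c ≤ s' t) :
    ∃ σ : ℝ → ℝ, (∀ x, 0 ≤ x → 0 ≤ σ x ∧ s (σ x) = x ∧ HasDerivAt σ (s' (σ x))⁻¹ x) ∧
      ∀ t, 0 ≤ t → σ (s t) = t := by
  classical
  -- The linear extension to negative times has the matching slope at 0, so S is differentiable on
  -- all of ℝ and its inverse has a two-sided derivative even at 0.
  set S : ℝ → ℝ := fun t => if 0 ≤ t then s t else s' 0 * t with hS
  have hSpos : ∀ t, 0 ≤ t → S t = s t := fun t ht => by simp [hS, ht]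
  have hSneg : ∀ t, t ≤ 0 → S t = s' 0 * t := by
    intro t ht
    rcases ht.lt_or_eq with h | h
    · simp [hS, not_le.2 h]
    · simp [hS, h, h0]
  have hd : ∀ t, HasDerivAt S (s' (max t 0)) t := by
    intro t
    have hR : 0 ≤ t → HasDerivWithinAt S (s' t) (Ici 0) t := fun ht =>
      (hs t ht).congr (fun x hx => hSpos x hx) (hSpos t ht)
    have hL : t ≤ 0 → HasDerivWithinAt S (s' 0) (Iic 0) t := fun ht => by
      have : HasDerivWithinAt (fun t => s' 0 * t) (s' 0) (Iic 0) t := by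
        simpa using ((hasDerivAt_id t).const_mul (s' 0)).hasDerivWithinAt
      exact this.congr (fun x hx => hSneg x hx) (hSneg t ht)
    rcases lt_trichotomy t 0 with h | h | h
    · rw [max_eq_right h.le]
      exact (hL h.le).hasDerivAt (Iic_mem_nhds h)
    · subst h
      simpa using (hL le_rfl).union (hR le_rfl)
    · rw [max_eq_left h.le]
      exact (hR h.le).hasDerivAt (Ici_mem_nhds h)
  have hge' : ∀ t, c ≤ s' (max t 0) := fun t => hge _ (le_max_right _ _)
  have hmono : StrictMono S := strictMono_of_deriv_pos fun t => by
    rw [(hd t).deriv]; exact hc.trans_le (hge' t)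
  have hcont : Continuous S := continuous_iff_continuousAt.2 fun t => (hd t).continuousAt
  have hlin : Monotone fun t => S t - c * t := by
    have hd' : ∀ t, HasDerivAt (fun t => S t - c * t) (s' (max t 0) - c) t := fun t => by
      simpa using (hd t).fun_sub ((hasDerivAt_id t).const_mul c)
    refine monotone_of_deriv_nonneg (fun t => (hd' t).differentiableAt) fun t => ?_
    rw [(hd' t).deriv]; linarith [hge' t]
  have hS0 : S 0 = 0 := by rw [hSpos 0 le_rfl, h0]
  have hsurj : Function.Surjective S := by
    refine hcont.surjective ?_ ?_
    · refine tendsto_atTop_mono' _ ?_ (tendsto_id.const_mul_atTop hc)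
      filter_upwards [eventually_ge_atTop 0] with t ht
      have := hlin ht
      simp only [hS0, id] at this ⊢
      linarith
    · refine tendsto_atBot_mono' _ ?_ (tendsto_id.const_mul_atBot hc)
      filter_upwards [eventually_le_atBot 0] with t ht
      have := hlin ht
      simp only [hS0, id] at this ⊢
      linarith
  set e := hmono.orderIsoOfSurjective S hsurj with he
  have heS : ∀ x, S (e.symm x) = x := fun x => e.apply_symm_apply x
  refine ⟨e.symm, fun x hx => ?_, fun t ht => by rw [← hSpos t ht]; exact e.symm_apply_apply t⟩
  have h1 : 0 ≤ e.symm x := by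
    rw [← hmono.le_iff_le, heS, hS0]; exact hx
  refine ⟨h1, by rw [← hSpos _ h1, heS], ?_⟩
  have hdx := hd (e.symm x)
  rw [max_eq_left h1] at hdx
  exact HasDerivAt.of_local_left_inverse e.symm.continuous.continuousAt hdx
    (hc.trans_le (hge _ h1)).ne' (Eventually.of_forall heS)

end Calculus

/-! ### Autonomous equations: uniqueness and Lipschitz dependence. -/

section ODE

theorem exists_lipschitzOnWith_closedBall {E : Type*} [NormedAddCommGroup E] [ProperSpace E]
    {f : E → E} (hf : LocallyLipschitz f) (x : E) (R : ℝ) :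
    ∃ K, LipschitzOnWith K f (closedBall x R) :=
  (hf.locallyLipschitzOn).exists_lipschitzOnWith_of_compact (isCompact_closedBall x R)

variable {E : Type*} [NormedAddCommGroup E] [NormedSpace ℝ E]

/-- `y` is an integral curve of the vector field `f` on `[0, T)`. -/
def IsSolution (f : E → E) (T : EReal) (y : ℝ → E) : Prop :=
  ∀ t ∈ lifespan T, HasDerivWithinAt y (f (y t)) (Ici 0) t

theorem IsSolution.mono {f : E → E} {T T' : EReal} {y : ℝ → E} (h : IsSolution f T y)
    (hT : T' ≤ T) : IsSolution f T' y := fun t ht => h t (lifespan_mono hT ht)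

theorem IsSolution.continuousOn {f : E → E} {T : EReal} {y : ℝ → E} (h : IsSolution f T y) :
    ContinuousOn y (lifespan T) :=
  fun t ht => (h t ht).continuousWithinAt.mono (lifespan_subset_Ici T)

theorem IsSolution.congr_field {f f₁ : E → E} {T : EReal} {y : ℝ → E} (h : IsSolution f T y)
    (hf : ∀ t ∈ lifespan T, f (y t) = f₁ (y t)) : IsSolution f₁ T y :=
  fun t ht => hf t ht ▸ h t ht

/-- Both arcs over [0, t] are compact, so they lie in one ball, on which a locally Lipschitz field
is Lipschitz; Grönwall's uniqueness then applies. -/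
theorem IsSolution.eq_of_initial_eq [ProperSpace E] {f : E → E} (hf : LocallyLipschitz f)
    {T T' : EReal} {y z : ℝ → E} (hy : IsSolution f T y) (hz : IsSolution f T' z)
    (h0 : y 0 = z 0) {t : ℝ} (ht : t ∈ lifespan T) (ht' : t ∈ lifespan T') : y t = z t := by
  have hm : ∀ x ∈ Icc 0 t, x ∈ lifespan T ∧ x ∈ lifespan T' := fun x hx =>
    ⟨mem_lifespan_of_le hx.1 hx.2 ht, mem_lifespan_of_le hx.1 hx.2 ht'⟩
  have hyc : ContinuousOn y (Icc 0 t) := hy.continuousOn.mono fun x hx => (hm x hx).1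
  have hzc : ContinuousOn z (Icc 0 t) := hz.continuousOn.mono fun x hx => (hm x hx).2
  obtain ⟨R, hR⟩ := ((isCompact_Icc.image_of_continuousOn hyc).isBounded.union
    (isCompact_Icc.image_of_continuousOn hzc).isBounded).subset_closedBall 0
  obtain ⟨K, hK⟩ := exists_lipschitzOnWith_closedBall hf 0 R
  refine ODE_solution_unique_of_mem_Icc_right (v := fun _ => f) (s := fun _ => closedBall 0 R)
    (fun _ _ => hK) hyc (fun x hx => ?_) (fun x hx => ?_) hzc (fun x hx => ?_) (fun x hx => ?_)
    h0 ⟨ht.1, le_rfl⟩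
  · exact (hy x (hm x (Ico_subset_Icc_self hx)).1).mono fun w hw => hx.1.trans hw
  · exact hR (Or.inl ⟨x, Ico_subset_Icc_self hx, rfl⟩)
  · exact (hz x (hm x (Ico_subset_Icc_self hx)).2).mono fun w hw => hx.1.trans hw
  · exact hR (Or.inr ⟨x, Ico_subset_Icc_self hx, rfl⟩)

/-- A bounded locally Lipschitz field has solutions on every bounded interval, and they depend in a
Lipschitz way on the initial value. -/
theorem exists_lipschitz_flow [ProperSpace E] [CompleteSpace E] {f : E → E}
    (hf : LocallyLipschitz f) {B : ℝ≥0} (hB : ∀ x, ‖f x‖ ≤ B) (x₀ : E) (r b : ℝ≥0) :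
    ∃ Y : E → ℝ → E, (∀ x ∈ closedBall x₀ r, Y x 0 = x ∧ IsSolution f b (Y x)) ∧
      ∃ L : ℝ≥0, ∀ t ∈ lifespan b, LipschitzOnWith L (Y · t) (closedBall x₀ r) := by
  -- At speed at most B, a curve starting within r of x₀ stays within B b + r up to time b, so this
  -- ball never limits the existence time.
  obtain ⟨K, hK⟩ := exists_lipschitzOnWith_closedBall hf x₀ (B * b + r)
  have hPL : IsPicardLindelof (fun _ => f) (tmin := 0) (tmax := b) ⟨0, le_rfl, b.2⟩ x₀
      (B * b + r) r B K :=
    { lipschitzOnWith := fun _ _ => by simpa using hK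
      continuousOn := fun _ _ => continuousOn_const
      norm_le := fun _ _ x _ => hB x
      mul_max_le := by simp }
  obtain ⟨Y, hY, L, hL⟩ := hPL.exists_forall_mem_closedBall_eq_hasDerivWithinAt_lipschitzOnWith
  refine ⟨Y, fun x hx => ⟨(hY x hx).1, fun t ht => ?_⟩, L, fun t ht => hL t ?_⟩
  · obtain ⟨h1, h2⟩ := mem_lifespan_coe.1 ht
    refine ((hY x hx).2 t ⟨h1, h2.le⟩).mono_of_mem_nhdsWithin ?_
    rw [← Ici_inter_Iic]
    exact inter_mem self_mem_nhdsWithin (mem_nhdsWithin_of_mem_nhds (Iic_mem_nhds h2))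
  · obtain ⟨h1, h2⟩ := mem_lifespan_coe.1 ht
    exact ⟨h1, h2.le⟩

end ODE

end SAMFlow

noncomputable section

namespace SAMFlow

open Set Filter Topology Metric
open scoped Gradient NNReal

/-! ### Moments and vector fields in logarithmic coordinates. -/

section LogCoordinates

variable {d : ℕ}

/-- `∑ μ_j^r β_j` for the symmetric parameter with weights `exp (y_j)`. -/
def logMoment (μ : Fin d → ℝ) (r : ℕ) (y : Fin d → ℝ) : ℝ := ∑ j, μ j ^ r * Real.exp (2 * y j)

/-- The center `m_c` in logarithmic coordinates. -/
def logCenter (μ : Fin d → ℝ) (ρ : ℝ) (y : Fin d → ℝ) : ℝ :=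
  Real.sqrt (2 * logMoment μ 2 y) / (2 * ρ)

/-- The ceiling `m_H` in logarithmic coordinates. -/
def logCeiling (μ : Fin d → ℝ) (y : Fin d → ℝ) : ℝ := logMoment μ 4 y / (2 * logMoment μ 3 y)

/-- The perturbed margin in logarithmic coordinates, for the inverse center `r = 1 / (2 m_c)`. -/
def logMargin (μ : Fin d → ℝ) (r : ℝ) (y : Fin d → ℝ) : ℝ :=
  ∑ j, μ j * Real.exp (2 * y j) * (1 - μ j * r) ^ 2

/-- The logistic speed factor at the perturbed point. -/
def gain (μ : Fin d → ℝ) (r : ℝ) (y : Fin d → ℝ) : ℝ := (1 + Real.exp (logMargin μ r y))⁻¹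

/-- The velocity of the logarithmic coordinates, for the inverse center `r`. -/
def logField (μ : Fin d → ℝ) (r : ℝ) (y : Fin d → ℝ) : Fin d → ℝ :=
  fun j => gain μ r y * (μ j * (1 - μ j * r))

/-- The inverse center `1 / (2 m_c)`. -/
def invCenter (μ : Fin d → ℝ) (ρ : ℝ) (y : Fin d → ℝ) : ℝ := (2 * logCenter μ ρ y)⁻¹

/-- The SAM vector field in logarithmic coordinates. -/
def samField (μ : Fin d → ℝ) (ρ : ℝ) (y : Fin d → ℝ) : Fin d → ℝ :=
  logField μ (invCenter μ ρ y) y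

/-- The SAM vector field with the inverse center cut off at `C`. -/
def truncField (μ : Fin d → ℝ) (ρ C : ℝ) (y : Fin d → ℝ) : Fin d → ℝ :=
  logField μ (min (invCenter μ ρ y) C) y

theorem gain_pos (μ : Fin d → ℝ) (r : ℝ) (y : Fin d → ℝ) : 0 < gain μ r y := by
  unfold gain; positivity

theorem gain_le_one (μ : Fin d → ℝ) (r : ℝ) (y : Fin d → ℝ) : gain μ r y ≤ 1 := by
  unfold gain
  exact inv_le_one_of_one_le₀ (by linarith [Real.exp_pos (logMargin μ r y)])

theorem contDiff_logMoment (μ : Fin d → ℝ) (r : ℕ) : ContDiff ℝ 1 (logMoment μ r) := by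
  unfold logMoment; fun_prop

theorem contDiff_logField (μ : Fin d → ℝ) :
    ContDiff ℝ 1 fun p : ℝ × (Fin d → ℝ) => logField μ p.1 p.2 := by
  have h1 : ContDiff ℝ 1 fun p : ℝ × (Fin d → ℝ) => logMargin μ p.1 p.2 := by
    unfold logMargin; fun_prop
  have h2 : ContDiff ℝ 1 fun p : ℝ × (Fin d → ℝ) => gain μ p.1 p.2 := by
    unfold gain
    exact (contDiff_const.add h1.exp).inv fun p => by positivity
  unfold logField
  exact contDiff_pi.2 fun j => h2.mul (by fun_prop)

/-- Since β_j' = 2 g μ_j (1 - μ_j r) β_j, differentiation only shifts the order of the moments. Only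
the value of r at time t enters, so it may be a plain number. -/
theorem hasDerivWithinAt_logMoment {μ : Fin d → ℝ} {r : ℝ} {y : ℝ → Fin d → ℝ} {S : Set ℝ} {t : ℝ}
    (h : HasDerivWithinAt y (logField μ r (y t)) S t) (n : ℕ) :
    HasDerivWithinAt (fun t => logMoment μ n (y t))
      (2 * gain μ r (y t) * (logMoment μ (n + 1) (y t) - r * logMoment μ (n + 2) (y t))) S t := by
  have hj : ∀ j, HasDerivWithinAt (fun t => μ j ^ n * Real.exp (2 * y t j))
      (μ j ^ n * (Real.exp (2 * y t j) * (2 * logField μ r (y t) j))) S t := fun j =>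
    (((hasDerivWithinAt_pi.1 h j).const_mul 2).exp).const_mul _
  have := HasDerivWithinAt.fun_sum (u := Finset.univ) fun j _ => hj j
  refine this.congr_deriv ?_
  simp only [logMoment, logField, Finset.mul_sum, ← Finset.sum_sub_distrib]
  exact Finset.sum_congr rfl fun j _ => by ring

end LogCoordinates

/-! ### Center, floor and ceiling for ordered positive features. -/

section Ordered

variable {k : ℕ} {μ : Fin (k + 2) → ℝ} {ρ : ℝ}

theorem feature_pos (h0 : 0 < μ 0) (hμ : StrictMono μ) (j : Fin (k + 2)) : 0 < μ j :=
  h0.trans_le (hμ.monotone (Fin.zero_le j))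

theorem logMoment_pos (h0 : 0 < μ 0) (hμ : StrictMono μ) (r : ℕ) (y : Fin (k + 2) → ℝ) :
    0 < logMoment μ r y :=
  Finset.sum_pos (fun j _ => mul_pos (pow_pos (feature_pos h0 hμ j) r) (Real.exp_pos _))
    Finset.univ_nonempty

theorem logCenter_pos (h0 : 0 < μ 0) (hμ : StrictMono μ) (hρ : 0 < ρ) (y : Fin (k + 2) → ℝ) :
    0 < logCenter μ ρ y :=
  div_pos (Real.sqrt_pos.2 (by linarith [logMoment_pos h0 hμ 2 y])) (by linarith)

theorem logCenter_sq (h0 : 0 < μ 0) (hμ : StrictMono μ) (hρ : 0 < ρ) (y : Fin (k + 2) → ℝ) :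
    2 * ρ ^ 2 * logCenter μ ρ y ^ 2 = logMoment μ 2 y := by
  rw [logCenter, div_pow, Real.sq_sqrt (by linarith [logMoment_pos h0 hμ 2 y])]
  field_simp

theorem contDiff_logCenter (h0 : 0 < μ 0) (hμ : StrictMono μ) (ρ : ℝ) :
    ContDiff ℝ 1 (logCenter μ ρ) := by
  unfold logCenter
  refine ContDiff.div_const (ContDiff.sqrt (contDiff_const.mul (contDiff_logMoment μ 2)) ?_) _
  intro y
  have := logMoment_pos h0 hμ 2 y
  positivity

theorem contDiff_invCenter (h0 : 0 < μ 0) (hμ : StrictMono μ) (hρ : 0 < ρ) :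
    ContDiff ℝ 1 (invCenter μ ρ) := by
  unfold invCenter
  refine (contDiff_const.mul (contDiff_logCenter h0 hμ ρ)).inv fun y => ?_
  have := logCenter_pos h0 hμ hρ y
  positivity

theorem continuous_logCeiling (h0 : 0 < μ 0) (hμ : StrictMono μ) : Continuous (logCeiling μ) := by
  unfold logCeiling
  refine (contDiff_logMoment μ 4).continuous.div
    (continuous_const.mul (contDiff_logMoment μ 3).continuous) fun y => ?_
  have := logMoment_pos h0 hμ 3 y
  positivity

theorem contDiff_samField (h0 : 0 < μ 0) (hμ : StrictMono μ) (hρ : 0 < ρ) :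
    ContDiff ℝ 1 (samField μ ρ) :=
  (contDiff_logField μ).comp (f := fun y => (invCenter μ ρ y, y))
    ((contDiff_invCenter h0 hμ hρ).prodMk contDiff_id)

/-- The minimum destroys differentiability but not the local Lipschitz property, which is all that
existence and uniqueness need. -/
theorem locallyLipschitz_truncField (h0 : 0 < μ 0) (hμ : StrictMono μ) (hρ : 0 < ρ) (C : ℝ) :
    LocallyLipschitz (truncField μ ρ C) :=
  (contDiff_logField μ).locallyLipschitz.comp (g := fun y => (min (invCenter μ ρ y) C, y))
    (((contDiff_invCenter h0 hμ hρ).locallyLipschitz.min_const C).prodMk LocallyLipschitz.id)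

theorem invCenter_pos (h0 : 0 < μ 0) (hμ : StrictMono μ) (hρ : 0 < ρ) (y : Fin (k + 2) → ℝ) :
    0 < invCenter μ ρ y := by
  have := logCenter_pos h0 hμ hρ y
  unfold invCenter; positivity

theorem exists_norm_truncField_le (h0 : 0 < μ 0) (hμ : StrictMono μ) (hρ : 0 < ρ) {C : ℝ}
    (hC : 0 < C) : ∃ B : ℝ≥0, ∀ y, ‖truncField μ ρ C y‖ ≤ B := by
  set M := μ (Fin.last (k + 1)) with hM
  have hM0 : 0 < M := feature_pos h0 hμ _
  refine ⟨⟨M * (1 + M * C), by positivity⟩, fun y => ?_⟩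
  refine (pi_norm_le_iff_of_nonneg (NNReal.coe_nonneg _)).2 fun j => ?_
  have hj := feature_pos h0 hμ j
  have hjM : μ j ≤ M := hμ.monotone (Fin.le_last j)
  have hr : 0 < min (invCenter μ ρ y) C := lt_min (invCenter_pos h0 hμ hρ y) hC
  have hrC : min (invCenter μ ρ y) C ≤ C := min_le_right _ _
  set r := min (invCenter μ ρ y) C with hrdef
  have h1 : |1 - μ j * r| ≤ 1 + M * C := by
    have : μ j * r ≤ M * C := mul_le_mul hjM hrC hr.le hM0.le
    have : 0 < μ j * r := by positivity
    rw [abs_le]; constructor <;> linarith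
  change ‖gain μ r y * (μ j * (1 - μ j * r))‖ ≤ M * (1 + M * C)
  rw [Real.norm_eq_abs, abs_mul, abs_mul, abs_of_pos (gain_pos _ _ _), abs_of_pos hj]
  calc gain μ r y * (μ j * |1 - μ j * r|) ≤ 1 * (M * (1 + M * C)) := by
        gcongr
        exact gain_le_one _ _ _
    _ = _ := one_mul _

theorem mul_logMoment_lt (h0 : 0 < μ 0) (hμ : StrictMono μ) (n : ℕ) (y : Fin (k + 2) → ℝ) :
    μ 0 * logMoment μ n y < logMoment μ (n + 1) y := by
  rw [← sub_pos]
  simp only [logMoment, Finset.mul_sum, ← Finset.sum_sub_distrib]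
  have e : ∀ j, μ j ^ (n + 1) * Real.exp (2 * y j) - μ 0 * (μ j ^ n * Real.exp (2 * y j)) =
      (μ j - μ 0) * (μ j ^ n * Real.exp (2 * y j)) := fun j => by ring
  simp only [e]
  have hp : ∀ j, 0 < μ j ^ n * Real.exp (2 * y j) := fun j =>
    mul_pos (pow_pos (feature_pos h0 hμ j) _) (Real.exp_pos _)
  exact Finset.sum_pos' (fun j _ => mul_nonneg (sub_nonneg.2 (hμ.monotone (Fin.zero_le j)))
    (hp j).le) ⟨1, Finset.mem_univ _, mul_pos (sub_pos.2 (hμ Fin.zero_lt_one)) (hp 1)⟩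

/-- The ceiling is half the mean of the features with weights μ_j³ β_j. All weights are positive and
some feature exceeds μ 0, so the inequality is strict. -/
theorem floor_lt_logCeiling (h0 : 0 < μ 0) (hμ : StrictMono μ) (y : Fin (k + 2) → ℝ) :
    mL μ < logCeiling μ y := by
  have h3 := logMoment_pos h0 hμ 3 y
  have hsum := mul_logMoment_lt h0 hμ 3 y
  rw [mL, logCeiling, div_lt_div_iff₀ two_pos (by positivity)]
  linarith

theorem logMoment_succ_le (h0 : 0 < μ 0) (hμ : StrictMono μ) (n : ℕ) (y : Fin (k + 2) → ℝ) :
    logMoment μ (n + 1) y ≤ μ (Fin.last (k + 1)) * logMoment μ n y := by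
  rw [logMoment, logMoment, Finset.mul_sum]
  refine Finset.sum_le_sum fun j _ => ?_
  have hj := feature_pos h0 hμ j
  have : 0 < μ j ^ n * Real.exp (2 * y j) := by positivity
  calc μ j ^ (n + 1) * Real.exp (2 * y j) = μ j * (μ j ^ n * Real.exp (2 * y j)) := by ring
    _ ≤ _ := mul_le_mul_of_nonneg_right (hμ.monotone (Fin.le_last j)) this.le

/-- Differentiate 2ρ² m_c² = A_2 and factor out A_3: the ceiling is exactly the value of the center
at which the center is stationary, and it repels. -/
theorem hasDerivWithinAt_logCenter (h0 : 0 < μ 0) (hμ : StrictMono μ) (hρ : 0 < ρ)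
    {y : ℝ → Fin (k + 2) → ℝ} {S : Set ℝ} {t : ℝ}
    (h : HasDerivWithinAt y (samField μ ρ (y t)) S t) :
    HasDerivWithinAt (fun t => logCenter μ ρ (y t))
      (gain μ (invCenter μ ρ (y t)) (y t) * logMoment μ 3 (y t) /
        (2 * ρ ^ 2 * logCenter μ ρ (y t) ^ 2) *
        (logCenter μ ρ (y t) - logCeiling μ (y t))) S t := by
  have hA2 := logMoment_pos h0 hμ 2 (y t)
  have hA3 := logMoment_pos h0 hμ 3 (y t)
  have hm := logCenter_pos h0 hμ hρ (y t)
  have hd := (((hasDerivWithinAt_logMoment h 2).const_mul 2).sqrt (by positivity)).div_const (2 * ρ)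
  refine hd.congr_deriv ?_
  have hs : Real.sqrt (2 * logMoment μ 2 (y t)) = 2 * ρ * logCenter μ ρ (y t) := by
    rw [logCenter]; field_simp
  rw [hs, invCenter, logCeiling]
  field_simp

theorem hasDerivWithinAt_logCeiling (h0 : 0 < μ 0) (hμ : StrictMono μ) 
    {y : ℝ → Fin (k + 2) → ℝ} {S : Set ℝ} {t : ℝ} {r : ℝ}
    (h : HasDerivWithinAt y (logField μ r (y t)) S t) :
    HasDerivWithinAt (fun t => logCeiling μ (y t))
      (gain μ r (y t) / logMoment μ 3 (y t) ^ 2 *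
        ((logMoment μ 5 (y t) - r * logMoment μ 6 (y t)) * logMoment μ 3 (y t) -
        logMoment μ 4 (y t) * (logMoment μ 4 (y t) - r * logMoment μ 5 (y t)))) S t := by
  have hA3 := logMoment_pos h0 hμ 3 (y t)
  have hd := (hasDerivWithinAt_logMoment h 4).fun_div ((hasDerivWithinAt_logMoment h 3).const_mul 2)
    (by positivity)
  refine hd.congr_deriv ?_
  field_simp

/-- The ceiling decreases where it meets the center. -/
theorem logCeiling_deriv_neg (h0 : 0 < μ 0) (hμ : StrictMono μ) (y : Fin (k + 2) → ℝ) {r : ℝ}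
    (hr : r * logMoment μ 4 y = logMoment μ 3 y) :
    (logMoment μ 5 y - r * logMoment μ 6 y) * logMoment μ 3 y -
        logMoment μ 4 y * (logMoment μ 4 y - r * logMoment μ 5 y) < 0 := by
  have hA3 := logMoment_pos h0 hμ 3 y
  have hA4 := logMoment_pos h0 hμ 4 y
  -- Multiplying the claim by A_4 and substituting r A_4 = A_3 turns its left side into minus this
  -- expression, a weighted sum of squares.
  have hsum : logMoment μ 3 y ^ 2 * logMoment μ 6 y - 2 * logMoment μ 3 y * logMoment μ 4 y *
      logMoment μ 5 y + logMoment μ 4 y ^ 2 * logMoment μ 4 y =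
      ∑ j, μ j ^ 4 * Real.exp (2 * y j) * (logMoment μ 3 y * μ j - logMoment μ 4 y) ^ 2 := by
    generalize logMoment μ 3 y = a
    generalize hb : logMoment μ 4 y = b
    -- In the cubic term one factor A_4 must become a sum again, while the other occurrences stay
    -- constants.
    nth_rewrite 3 [← hb]
    simp only [logMoment, Finset.mul_sum, ← Finset.sum_sub_distrib, ← Finset.sum_add_distrib]
    exact Finset.sum_congr rfl fun j _ => by ring
  have hpos : 0 < ∑ j, μ j ^ 4 * Real.exp (2 * y j) *
      (logMoment μ 3 y * μ j - logMoment μ 4 y) ^ 2 := by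
    have hp : ∀ j, 0 < μ j ^ 4 * Real.exp (2 * y j) := fun j =>
      mul_pos (pow_pos (feature_pos h0 hμ j) _) (Real.exp_pos _)
    refine Finset.sum_pos' (fun j _ => mul_nonneg (hp j).le (sq_nonneg _))
      ⟨0, Finset.mem_univ _, mul_pos (hp 0) (sq_pos_of_neg ?_)⟩
    linarith [mul_logMoment_lt h0 hμ 3 y]
  refine neg_of_mul_neg_left (b := logMoment μ 4 y) ?_ hA4.le
  rw [← hsum] at hpos
  refine lt_of_eq_of_lt ?_ (neg_neg_of_pos hpos)
  linear_combination (logMoment μ 4 y * logMoment μ 5 y - logMoment μ 3 y * logMoment μ 6 y) * hr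

/-- At a zero the center is stationary, so the derivative is minus that of the ceiling. One function
`D` serves all times, the form the barrier lemma takes. -/
theorem hasDerivWithinAt_center_sub_ceiling_pos (h0 : 0 < μ 0) (hμ : StrictMono μ) (hρ : 0 < ρ)
    (y : ℝ → Fin (k + 2) → ℝ) : ∃ D : ℝ → ℝ, ∀ (S : Set ℝ) (t : ℝ),
      HasDerivWithinAt y (samField μ ρ (y t)) S t →
      HasDerivWithinAt (fun t => logCenter μ ρ (y t) - logCeiling μ (y t)) (D t) S t ∧
      (logCenter μ ρ (y t) - logCeiling μ (y t) = 0 → 0 < D t) := by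
  refine ⟨_, fun S t h => ⟨(hasDerivWithinAt_logCenter h0 hμ hρ h).fun_sub
    (hasDerivWithinAt_logCeiling h0 hμ h), fun hz => ?_⟩⟩
  have hA3 := logMoment_pos h0 hμ 3 (y t)
  have hA4 := logMoment_pos h0 hμ 4 (y t)
  have hg := gain_pos μ (invCenter μ ρ (y t)) (y t)
  have hr : invCenter μ ρ (y t) * logMoment μ 4 (y t) = logMoment μ 3 (y t) := by
    rw [invCenter, sub_eq_zero.1 hz, logCeiling]
    field_simp
  have := logCeiling_deriv_neg h0 hμ (y t) hr
  rw [hz, mul_zero, zero_sub, neg_pos]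
  exact mul_neg_of_pos_of_neg (by positivity) this

/-- The speed factor is bounded below where the center is bounded above. -/
theorem exists_le_gain (h0 : 0 < μ 0) (hμ : StrictMono μ) (hρ : 0 < ρ) (B : ℝ) :
    ∃ c : ℝ, 0 < c ∧ ∀ y, logCenter μ ρ y ≤ B → c ≤ gain μ (invCenter μ ρ y) y := by
  -- From (1 - μ_j r)² ≤ 2 + 2 μ_j² r² the margin is at most 2 A_1 + 2 r² A_3. The first term is
  -- bounded through A_1 ≤ A_2/μ 0. In the second, A_3 ≤ μ_d A_2 and r² A_2 = ρ²/2, so no lower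
  -- bound on the center is needed.
  set Q := 4 * ρ ^ 2 * B ^ 2 / μ 0 + μ (Fin.last (k + 1)) * ρ ^ 2 with hQ
  refine ⟨(1 + Real.exp Q)⁻¹, by positivity, fun y hy => ?_⟩
  unfold gain
  have hm := logCenter_pos h0 hμ hρ y
  have hle : logMargin μ (invCenter μ ρ y) y ≤ Q := by
    set r := invCenter μ ρ y with hr
    have h1 : logMargin μ r y ≤ 2 * logMoment μ 1 y + 2 * r ^ 2 * logMoment μ 3 y := by
      simp only [logMargin, logMoment, Finset.mul_sum, ← Finset.sum_add_distrib]
      refine Finset.sum_le_sum fun j _ => ?_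
      have hj : 0 < μ j * Real.exp (2 * y j) := mul_pos (feature_pos h0 hμ j) (Real.exp_pos _)
      have : (1 - μ j * r) ^ 2 ≤ 2 + 2 * (μ j * r) ^ 2 := by nlinarith [sq_nonneg (1 + μ j * r)]
      calc _ ≤ μ j * Real.exp (2 * y j) * (2 + 2 * (μ j * r) ^ 2) :=
            mul_le_mul_of_nonneg_left this hj.le
        _ = _ := by ring
    have h2 : logMoment μ 1 y ≤ 2 * ρ ^ 2 * B ^ 2 / μ 0 := by
      rw [le_div_iff₀ h0]
      have := mul_logMoment_lt h0 hμ 1 y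
      have h4 : logCenter μ ρ y ^ 2 ≤ B ^ 2 := pow_le_pow_left₀ hm.le hy 2
      have h5 := logCenter_sq h0 hμ hρ y
      have h6 : 2 * ρ ^ 2 * logCenter μ ρ y ^ 2 ≤ 2 * ρ ^ 2 * B ^ 2 := by gcongr
      norm_num at this
      linarith
    have h3 : 2 * r ^ 2 * logMoment μ 3 y ≤ μ (Fin.last (k + 1)) * ρ ^ 2 := by
      have := logMoment_succ_le h0 hμ 2 y
      calc 2 * r ^ 2 * logMoment μ 3 y ≤ 2 * r ^ 2 * (μ (Fin.last (k + 1)) * logMoment μ 2 y) := by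
            gcongr
        _ = _ := by
            rw [← logCenter_sq h0 hμ hρ y, hr, invCenter]
            field_simp
    calc _ ≤ _ := h1
      _ ≤ 2 * (2 * ρ ^ 2 * B ^ 2 / μ 0) + μ (Fin.last (k + 1)) * ρ ^ 2 := by gcongr
      _ = Q := by rw [hQ]; ring
  gcongr

end Ordered

end SAMFlow

end

noncomputable section

namespace SAMFlow

open Set Filter Topology Metric
open scoped Gradient NNReal

/-! ### The gradient of the loss and the perturbed gradient. -/

section Gradient

variable {d : ℕ}

/-- The gradient of the training loss. -/
def lossGrad (μ : Fin d → ℝ) (θ : Params d) : Params d :=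
  WithLp.toLp 2 fun p => -(1 + Real.exp (margin μ θ))⁻¹ * (μ p.2 * θ (1 - p.1, p.2))

theorem lossGrad_apply (μ : Fin d → ℝ) (θ : Params d) (p : Fin 2 × Fin d) :
    lossGrad μ θ p = -(1 + Real.exp (margin μ θ))⁻¹ * (μ p.2 * θ (1 - p.1, p.2)) := rfl

theorem hasDerivAt_logistic (s : ℝ) : HasDerivAt logistic (-(1 + Real.exp s)⁻¹) s := by
  have h : HasDerivAt logistic _ s :=
    (((hasDerivAt_neg s).exp).const_add 1).log (by positivity)
  refine h.congr_deriv ?_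
  rw [Real.exp_neg]
  have := Real.exp_pos s
  field_simp
  ring

theorem gradient_loss (μ : Fin d → ℝ) (θ : Params d) : ∇ (loss μ) θ = lossGrad μ θ := by
  refine HasGradientAt.gradient ?_
  rw [hasGradientAt_iff_hasFDerivAt]
  have hc : ∀ p, HasFDerivAt (fun θ : Params d => θ p) (EuclideanSpace.proj p : Params d →L[ℝ] ℝ) θ :=
    fun p => (EuclideanSpace.proj p : Params d →L[ℝ] ℝ).hasFDerivAt
  have hm : HasFDerivAt (margin μ) _ θ :=
    HasFDerivAt.fun_sum (u := Finset.univ) fun j _ => ((hc (0, j)).mul (hc (1, j))).mul_const (μ j)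
  have h := (hasDerivAt_logistic (margin μ θ)).comp_hasFDerivAt θ hm
  refine HasFDerivAt.congr_fderiv h ?_
  ext v
  simp [PiLp.inner_apply, lossGrad_apply, Fintype.sum_prod_type, Fin.sum_univ_two, Finset.mul_sum,
    ← Finset.sum_add_distrib]
  exact Finset.sum_congr rfl fun j _ => by ring

theorem norm_lossGrad (μ : Fin d → ℝ) (θ : Params d) :
    ‖lossGrad μ θ‖ = (1 + Real.exp (margin μ θ))⁻¹ * nTheta μ θ := by
  have hg : 0 ≤ (1 + Real.exp (margin μ θ))⁻¹ := by positivity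
  rw [EuclideanSpace.norm_eq, nTheta, ← Real.sqrt_sq hg, ← Real.sqrt_mul (sq_nonneg _)]
  congr 1
  simp only [lossGrad_apply, Fintype.sum_prod_type, Fin.sum_univ_two, Finset.mul_sum,
    ← Finset.sum_add_distrib, Real.norm_eq_abs, sq_abs]
  generalize (1 + Real.exp (margin μ θ))⁻¹ = g
  exact Finset.sum_congr rfl fun j _ => by simp; ring

theorem nTheta_pos_of_gradient_ne_zero {μ : Fin d → ℝ} {θ : Params d}
    (h : ∇ (loss μ) θ ≠ 0) : 0 < nTheta μ θ := by
  rw [gradient_loss, ← norm_pos_iff, norm_lossGrad] at h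
  exact pos_of_mul_pos_right h (by positivity)

/-- The logistic factor cancels between the gradient and its norm. The index `1 - p.1` is the other
layer, and the minus sign reflects that the loss decreases in the margin. -/
theorem perturbed_apply {μ : Fin d → ℝ} {ρ : ℝ} {θ : Params d} (h : 0 < nTheta μ θ)
    (p : Fin 2 × Fin d) :
    perturbed μ ρ θ p = θ p - ρ / nTheta μ θ * (μ p.2 * θ (1 - p.1, p.2)) := by
  rw [perturbed, gradient_loss, norm_lossGrad, PiLp.add_apply, PiLp.smul_apply, lossGrad_apply,
    smul_eq_mul]
  have : 0 < 1 + Real.exp (margin μ θ) := by positivity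
  field_simp
  ring

/-- The speed factor of the SAM flow at a general parameter. -/
def paramGain (μ : Fin d → ℝ) (ρ : ℝ) (θ : Params d) : ℝ :=
  (1 + Real.exp (margin μ (perturbed μ ρ θ)))⁻¹

/-- The gradient swaps the layers and so does the perturbation; the two swaps bring the second-order
term back to `θ p`. -/
theorem neg_gradient_perturbed_apply {μ : Fin d → ℝ} {ρ : ℝ} {θ : Params d} (h : 0 < nTheta μ θ)
    (p : Fin 2 × Fin d) :
    (-∇ (loss μ) (perturbed μ ρ θ)) p = paramGain μ ρ θ *
      (μ p.2 * (θ (1 - p.1, p.2) - ρ / nTheta μ θ * (μ p.2 * θ p))) := by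
  rw [gradient_loss, PiLp.neg_apply, lossGrad_apply, perturbed_apply h, paramGain]
  simp

theorem margin_perturbed {μ : Fin d → ℝ} {ρ : ℝ} {θ : Params d} (h : 0 < nTheta μ θ) :
    margin μ (perturbed μ ρ θ) = ∑ j, (θ (0, j) - ρ / nTheta μ θ * (μ j * θ (1, j))) *
      (θ (1, j) - ρ / nTheta μ θ * (μ j * θ (0, j))) * μ j := by
  simp [margin, beta, perturbed_apply h]

end Gradient

/-! ### Symmetric positive parameters. -/

section ExpParam

variable {d : ℕ}

/-- The symmetric parameter with positive weights `exp (y_j)`. -/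
def expParam (y : Fin d → ℝ) : Params d := WithLp.toLp 2 fun p => Real.exp (y p.2)

theorem expParam_apply (y : Fin d → ℝ) (p : Fin 2 × Fin d) : expParam y p = Real.exp (y p.2) := rfl

theorem beta_expParam (y : Fin d → ℝ) (j : Fin d) : beta (expParam y) j = Real.exp (2 * y j) := by
  rw [beta, expParam_apply, expParam_apply, ← Real.exp_add, two_mul]

theorem nTheta_expParam (μ : Fin d → ℝ) (y : Fin d → ℝ) :
    nTheta μ (expParam y) = Real.sqrt (2 * logMoment μ 2 y) := by
  rw [nTheta, logMoment, Finset.mul_sum]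
  congr 1
  refine Finset.sum_congr rfl fun j _ => ?_
  rw [expParam_apply, expParam_apply, two_mul (y j), Real.exp_add]
  ring

theorem mc_expParam (μ : Fin d → ℝ) (ρ : ℝ) (y : Fin d → ℝ) :
    mc μ ρ (expParam y) = logCenter μ ρ y := by
  rw [mc, nTheta_expParam, logCenter]

theorem div_nTheta_expParam (μ : Fin d → ℝ) (ρ : ℝ) (y : Fin d → ℝ) (hρ : 0 < ρ) :
    ρ / nTheta μ (expParam y) = invCenter μ ρ y := by
  rw [nTheta_expParam, invCenter, logCenter]
  field_simp

end ExpParam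

/-! ### Equivalence of SAM flows and solutions in logarithmic coordinates. -/

section

variable {k : ℕ} {μ : Fin (k + 2) → ℝ} {ρ : ℝ}

/-- The order shifts by two because the weights p_j already carry μ_j². -/
theorem moment_expParam (μ : Fin (k + 2) → ℝ) (r : ℕ) (y : Fin (k + 2) → ℝ) :
    moment μ r (expParam y) = logMoment μ (r + 2) y / logMoment μ 2 y := by
  simp only [moment, prop, beta_expParam, logMoment, Finset.sum_div]
  exact Finset.sum_congr rfl fun j _ => by ring

theorem mH_expParam (h0 : 0 < μ 0) (hμ : StrictMono μ) (y : Fin (k + 2) → ℝ) :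
    mH μ (expParam y) = logCeiling μ y := by
  have h2 := logMoment_pos h0 hμ 2 y
  have h3 := logMoment_pos h0 hμ 3 y
  rw [mH, moment_expParam, moment_expParam, logCeiling]
  field_simp

theorem nTheta_expParam_pos (h0 : 0 < μ 0) (hμ : StrictMono μ) (y : Fin (k + 2) → ℝ) :
    0 < nTheta μ (expParam y) := by
  have h2 := logMoment_pos h0 hμ 2 y
  rw [nTheta_expParam]
  positivity

theorem gradient_expParam_ne_zero (h0 : 0 < μ 0) (hμ : StrictMono μ) (y : Fin (k + 2) → ℝ) :
    ∇ (loss μ) (expParam y) ≠ 0 := by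
  have := nTheta_expParam_pos h0 hμ y
  rw [gradient_loss, ← norm_pos_iff, norm_lossGrad]
  positivity

theorem paramGain_expParam (h0 : 0 < μ 0) (hμ : StrictMono μ) (hρ : 0 < ρ)
    (y : Fin (k + 2) → ℝ) :
    paramGain μ ρ (expParam y) = gain μ (invCenter μ ρ y) y := by
  rw [paramGain, gain, margin_perturbed (nTheta_expParam_pos h0 hμ y), div_nTheta_expParam _ _ _ hρ,
    logMargin]
  congr 3
  refine Finset.sum_congr rfl fun j _ => ?_
  simp only [expParam_apply, two_mul (y j), Real.exp_add]
  ring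

theorem neg_gradient_perturbed_expParam (h0 : 0 < μ 0) (hμ : StrictMono μ) (hρ : 0 < ρ)
    (y : Fin (k + 2) → ℝ) (p : Fin 2 × Fin (k + 2)) :
    (-∇ (loss μ) (perturbed μ ρ (expParam y))) p = Real.exp (y p.2) * samField μ ρ y p.2 := by
  rw [neg_gradient_perturbed_apply (nTheta_expParam_pos h0 hμ y), paramGain_expParam h0 hμ hρ,
    div_nTheta_expParam _ _ _ hρ, samField, logField, expParam_apply, expParam_apply]
  ring

theorem hasDerivWithinAt_params {d : ℕ} {θ : ℝ → Params d} {θ' : Params d} {S : Set ℝ} {t : ℝ} :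
    HasDerivWithinAt θ θ' S t ↔ ∀ p, HasDerivWithinAt (fun t => θ t p) (θ' p) S t := by
  rw [hasDerivWithinAt_iff_hasFDerivWithinAt, hasFDerivWithinAt_euclidean]
  refine forall_congr' fun p => ?_
  rw [hasDerivWithinAt_iff_hasFDerivWithinAt]
  have e : PiLp.proj 2 (fun _ => ℝ) p ∘L (ContinuousLinearMap.toSpanSingleton ℝ θ') =
      ContinuousLinearMap.toSpanSingleton ℝ (θ' p) := by
    ext; simp
  rw [e]

/-- A solution in logarithmic coordinates is a SAM flow. -/
theorem IsSolution.isFlow (h0 : 0 < μ 0) (hμ : StrictMono μ) (hρ : 0 < ρ) {α : ℝ} (hα : 0 < α)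
    {T : EReal} (hT : 0 < T) {y : ℝ → Fin (k + 2) → ℝ} (hy : IsSolution (samField μ ρ) T y)
    (hy0 : y 0 = fun _ => Real.log α) : IsFlow μ ρ α T fun t => expParam (y t) where
  pos := hT
  init := fun p => by rw [expParam_apply, hy0, Real.exp_log hα]
  grad_ne_zero := fun t _ => gradient_expParam_ne_zero h0 hμ (y t)
  deriv := fun t ht => hasDerivWithinAt_params.2 fun p => by
    rw [neg_gradient_perturbed_expParam h0 hμ hρ]
    exact (hasDerivWithinAt_pi.1 (hy t ht) p.2).exp

/-- A solution of a homogeneous linear equation is a positive multiple of its initial value. -/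
theorem exists_eq_mul_exp_of_linear {T : EReal} {u a : ℝ → ℝ}
    (hu : ∀ t ∈ lifespan T, HasDerivWithinAt u (a t * u t) (Ici 0) t)
    (ha : ContinuousOn a (lifespan T)) {t : ℝ} (ht : t ∈ lifespan T) :
    ∃ c, u t = u 0 * Real.exp c := by
  have hsub : Icc 0 t ⊆ lifespan T := fun x hx => mem_lifespan_of_le hx.1 hx.2 ht
  -- The coefficient is continuous only on the lifespan; extending it by constants outside [0, t]
  -- gives a primitive differentiable everywhere.
  set b : ℝ → ℝ := IccExtend ht.1 (domRestrict (Icc 0 t) a) with hb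
  have hbc : Continuous b := (continuousOn_iff_continuous_domRestrict.1 (ha.mono hsub)).Icc_extend'
  have hba : ∀ x ∈ Icc 0 t, b x = a x := fun x hx => by
    rw [hb, IccExtend_of_mem _ _ hx]; rfl
  set A : ℝ → ℝ := fun x => ∫ s in (0 : ℝ)..x, b s with hA
  have hAd : ∀ x, HasDerivAt A (b x) x := fun x => hbc.integral_hasStrictDerivAt 0 x |>.hasDerivAt
  have hd : ∀ x ∈ Icc 0 t, HasDerivWithinAt (fun x => u x * Real.exp (-A x)) 0 (Ici 0) x := by
    intro x hx
    refine ((hu x (hsub hx)).mul ((hAd x).hasDerivWithinAt.neg.exp)).congr_deriv ?_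
    rw [hba x hx]; ring
  have hconst := constant_of_has_deriv_right_zero (f := fun x => u x * Real.exp (-A x))
    (a := 0) (b := t) (fun x hx => (hd x hx).continuousWithinAt.mono fun z hz => hz.1)
    (fun x hx => (hd x (Ico_subset_Icc_self hx)).mono fun z hz => hx.1.trans hz) t ⟨ht.1, le_rfl⟩
  have hA0 : A 0 = 0 := by simp [hA]
  refine ⟨A t, ?_⟩
  simp only [hA0, neg_zero, Real.exp_zero, mul_one] at hconst
  rw [← hconst, mul_assoc, ← Real.exp_add]
  simp

/-- Along a SAM flow both layers agree and are positive, and their logarithms solve the SAM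
equation in logarithmic coordinates. -/
theorem IsFlow.exists_isSolution (h0 : 0 < μ 0) (hμ : StrictMono μ) (hρ : 0 < ρ) {α : ℝ}
    (hα : 0 < α) {T : EReal} {θ : ℝ → Params (k + 2)} (h : IsFlow μ ρ α T θ) :
    ∃ y : ℝ → Fin (k + 2) → ℝ, IsSolution (samField μ ρ) T y ∧ (y 0 = fun _ => Real.log α) ∧
      ∀ t ∈ lifespan T, θ t = expParam (y t) := by
  have hn : ∀ t ∈ lifespan T, 0 < nTheta μ (θ t) := fun t ht =>
    nTheta_pos_of_gradient_ne_zero (h.grad_ne_zero t ht)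
  have hd : ∀ t ∈ lifespan T, ∀ p : Fin 2 × Fin (k + 2), HasDerivWithinAt (fun t => θ t p)
      (paramGain μ ρ (θ t) *
      (μ p.2 * (θ t (1 - p.1, p.2) - ρ / nTheta μ (θ t) * (μ p.2 * θ t p)))) (Ici 0) t := by
    intro t ht p
    have := hasDerivWithinAt_params.1 (h.deriv t ht) p
    rwa [neg_gradient_perturbed_apply (hn t ht)] at this
  have hc : ∀ p, ContinuousOn (fun t => θ t p) (lifespan T) := fun p t ht =>
    (hd t ht p).continuousWithinAt.mono (lifespan_subset_Ici T)
  have hcr : ContinuousOn (fun t => ρ / nTheta μ (θ t)) (lifespan T) := by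
    refine continuousOn_const.div ?_ fun t ht => (hn t ht).ne'
    unfold nTheta
    refine (continuousOn_finsetSum _ fun j _ => ?_).sqrt
    have h1 := hc (0, j)
    have h2 := hc (1, j)
    fun_prop
  have hcm : ContinuousOn (fun t => margin μ (perturbed μ ρ (θ t))) (lifespan T) := by
    refine ContinuousOn.congr ?_ fun t ht => margin_perturbed (hn t ht)
    refine continuousOn_finsetSum _ fun j _ => ?_
    have h1 := hc (0, j)
    have h2 := hc (1, j)
    fun_prop
  have hcg : ContinuousOn (fun t => paramGain μ ρ (θ t)) (lifespan T) := by
    unfold paramGain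
    exact (continuousOn_const.add hcm.rexp).inv₀ fun t _ =>
      (add_pos one_pos (Real.exp_pos _)).ne'
  -- The layer sum solves a linear equation with initial value 2α, hence stays positive; the
  -- difference below does the same from 0, hence vanishes.
  have hsum : ∀ t ∈ lifespan T, ∀ j, 0 < θ t (0, j) + θ t (1, j) := by
    intro t ht j
    obtain ⟨c, hc'⟩ := exists_eq_mul_exp_of_linear (T := T)
      (u := fun t => θ t (0, j) + θ t (1, j))
      (a := fun t => paramGain μ ρ (θ t) * (μ j * (1 - ρ / nTheta μ (θ t) * μ j)))
      (fun t ht => ((hd t ht (0, j)).fun_add (hd t ht (1, j))).congr_deriv (by simp; ring))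
      (hcg.mul (continuousOn_const.mul (continuousOn_const.sub (hcr.mul continuousOn_const)))) ht
    simp only [h.init] at hc'
    rw [hc']
    positivity
  have hdiff : ∀ t ∈ lifespan T, ∀ j, θ t (0, j) - θ t (1, j) = 0 := by
    intro t ht j
    obtain ⟨c, hc'⟩ := exists_eq_mul_exp_of_linear (T := T)
      (u := fun t => θ t (0, j) - θ t (1, j))
      (a := fun t => paramGain μ ρ (θ t) * (μ j * (-1 - ρ / nTheta μ (θ t) * μ j)))
      (fun t ht => ((hd t ht (0, j)).fun_sub (hd t ht (1, j))).congr_deriv (by simp; ring))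
      (hcg.mul (continuousOn_const.mul (continuousOn_const.sub (hcr.mul continuousOn_const)))) ht
    simpa [h.init] using hc'
  have hpos : ∀ t ∈ lifespan T, ∀ p, 0 < θ t p ∧ θ t p = θ t (0, p.2) := by
    rintro t ht ⟨i, j⟩
    have h1 := hsum t ht j
    have h2 := hdiff t ht j
    fin_cases i
    · exact ⟨by simp; linarith, rfl⟩
    · exact ⟨by simp; linarith, by simp; linarith⟩
  have hθ : ∀ t ∈ lifespan T, θ t = expParam fun j => Real.log (θ t (0, j)) := by
    intro t ht
    ext p
    rw [expParam_apply, Real.exp_log (hpos t ht _).1]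
    exact (hpos t ht p).2
  refine ⟨fun t j => Real.log (θ t (0, j)), fun t ht => hasDerivWithinAt_pi.2 fun j => ?_, ?_, hθ⟩
  · have hdj := hasDerivWithinAt_params.1 (h.deriv t ht) (0, j)
    have hval := neg_gradient_perturbed_expParam h0 hμ hρ (fun j => Real.log (θ t (0, j))) (0, j)
    rw [← hθ t ht] at hval
    rw [hval] at hdj
    refine (hdj.log (hpos t ht _).1.ne').congr_deriv ?_
    rw [Real.exp_log (hpos t ht _).1]
    exact mul_div_cancel_left₀ _ (hpos t ht (0, j)).1.ne'
  · simp only [h.init]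

end

end SAMFlow

end

noncomputable section

namespace SAMFlow

open Set Filter Topology Metric
open scoped Gradient NNReal

/-! ### Maximal solutions: existence, continuation, dependence on the scale. -/

theorem lifespan_mem_nhdsWithin {T : EReal} {t : ℝ} (ht : t ∈ lifespan T) :
    lifespan T ∈ 𝓝[Ici 0] t := by
  obtain ⟨t', ht', hlt⟩ := exists_lt_mem_lifespan ht
  filter_upwards [self_mem_nhdsWithin, mem_nhdsWithin_of_mem_nhds (Iio_mem_nhds hlt)] with x hx hx'
  exact mem_lifespan_of_le hx (le_of_lt hx') ht'

theorem IsSolution.congr {E : Type*} [NormedAddCommGroup E] [NormedSpace ℝ E] {f : E → E}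
    {T : EReal} {y z : ℝ → E} (h : IsSolution f T z) (hyz : ∀ t ∈ lifespan T, y t = z t) :
    IsSolution f T y := fun t ht => by
  rw [hyz t ht]
  refine (h t ht).congr_of_eventuallyEq ?_ (hyz t ht)
  filter_upwards [lifespan_mem_nhdsWithin ht] with x hx using hyz x hx

variable {k : ℕ} {μ : Fin (k + 2) → ℝ} {ρ α : ℝ}

/-- A maximal solution of the SAM equation in logarithmic coordinates, starting at `log α`. -/
structure IsMaximalSolution (μ : Fin (k + 2) → ℝ) (ρ α : ℝ) (T : EReal)
    (y : ℝ → Fin (k + 2) → ℝ) : Prop where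
  pos : 0 < T
  sol : IsSolution (samField μ ρ) T y
  start : y 0 = fun _ => Real.log α
  maximal : ∀ (T' : EReal) (z : ℝ → Fin (k + 2) → ℝ), IsSolution (samField μ ρ) T' z →
    (z 0 = fun _ => Real.log α) → T' ≤ T

/-- Maximality among extensions upgrades to maximality among all solutions with the same start,
since by uniqueness a longer solution is an extension. -/
theorem IsMaximalFlow.exists_isMaximalSolution (h0 : 0 < μ 0) (hμ : StrictMono μ) (hρ : 0 < ρ)
    (hα : 0 < α) {T : EReal} {θ : ℝ → Params (k + 2)} (h : IsMaximalFlow μ ρ α T θ) :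
    ∃ y, IsMaximalSolution μ ρ α T y ∧ ∀ t ∈ lifespan T, θ t = expParam (y t) := by
  obtain ⟨y, hy, hy0, hθ⟩ := h.toIsFlow.exists_isSolution h0 hμ hρ hα
  refine ⟨y, ⟨h.pos, hy, hy0, fun T' z hz hz0 => ?_⟩, hθ⟩
  by_contra! hlt
  refine hlt.not_ge (h.maximal T' _ (hz.isFlow h0 hμ hρ hα (h.pos.trans hlt) hz0) fun t ht => ?_)
  rw [hθ t ht]
  exact congrArg expParam (hz.eq_of_initial_eq (contDiff_samField h0 hμ hρ).locallyLipschitz hy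
    (hz0.trans hy0.symm) (lifespan_mono hlt.le ht) ht)

theorem exists_isMaximalSolution (h0 : 0 < μ 0) (hμ : StrictMono μ) (hρ : 0 < ρ) (α : ℝ) :
    ∃ T y, IsMaximalSolution μ ρ α T y := by
  have hL := (contDiff_samField h0 hμ hρ).locallyLipschitz
  set 𝒯 : Set EReal := {b | ∃ z, IsSolution (samField μ ρ) b z ∧ z 0 = fun _ => Real.log α} with h𝒯
  obtain ⟨z₀, hz₀, ε, hε, hz₀'⟩ :=
    (contDiff_samField h0 hμ hρ).contDiffAt
      (x := fun _ => Real.log α).exists_forall_mem_closedBall_exists_eq_forall_mem_Ioo_hasDerivAt₀ 0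
  have hε𝒯 : (ε : EReal) ∈ 𝒯 := by
    refine ⟨z₀, fun t ht => ?_, hz₀⟩
    obtain ⟨h1, h2⟩ := mem_lifespan_coe.1 ht
    exact (hz₀' t ⟨by linarith, by linarith⟩).hasDerivWithinAt
  -- Any two solutions alive at t agree there, so their common value defines the glued solution up
  -- to the supremum of the existence times.
  have key : ∀ t ∈ lifespan (sSup 𝒯), ∃ v, ∀ (b : EReal) (z : ℝ → Fin (k + 2) → ℝ),
      IsSolution (samField μ ρ) b z → (z 0 = fun _ => Real.log α) → t ∈ lifespan b → z t = v := by
    intro t ht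
    obtain ⟨b, ⟨z, hz, hz0⟩, hb⟩ := lt_sSup_iff.1 ht.2
    exact ⟨z t, fun b' z' hz' hz0' ht' =>
      hz'.eq_of_initial_eq hL hz (hz0'.trans hz0.symm) ht' ⟨ht.1, hb⟩⟩
  choose! y hy using key
  have hpos : 0 < sSup 𝒯 := lt_sSup_iff.2 ⟨ε, hε𝒯, by exact_mod_cast hε⟩
  refine ⟨sSup 𝒯, y, hpos, fun t ht => ?_, ?_, fun T' z hz hz0 => le_sSup ⟨z, hz, hz0⟩⟩
  · obtain ⟨b, hb𝒯, hb⟩ := lt_sSup_iff.1 ht.2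
    have hle := le_sSup hb𝒯
    obtain ⟨z, hz, hz0⟩ := hb𝒯
    exact hz.congr (fun s hs => (hy s (lifespan_mono hle hs) b z hz hz0 hs).symm)
      t ⟨ht.1, hb⟩
  · rw [← hz₀]
    obtain ⟨z, hz, hz0⟩ := hε𝒯
    rw [hz₀, ← hz0]
    exact (hy 0 (zero_mem_lifespan hpos) ε z hz hz0
      (zero_mem_lifespan (by exact_mod_cast hε))).symm

theorem exists_isMaximalFlow (h0 : 0 < μ 0) (hμ : StrictMono μ) (hρ : 0 < ρ) (hα : 0 < α) :
    ∃ T θ, IsMaximalFlow μ ρ α T θ := by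
  obtain ⟨T, y, hy⟩ := exists_isMaximalSolution h0 hμ hρ α
  refine ⟨T, fun t => expParam (y t), hy.sol.isFlow h0 hμ hρ hα hy.pos hy.start, ?_⟩
  intro T' θ' hθ' _
  obtain ⟨z, hz, hz0, -⟩ := hθ'.exists_isSolution h0 hμ hρ hα
  exact hy.maximal T' z hz hz0

theorem IsMaximalSolution.unique (h0 : 0 < μ 0) (hμ : StrictMono μ) (hρ : 0 < ρ) {T T' : EReal}
    {y y' : ℝ → Fin (k + 2) → ℝ} (h : IsMaximalSolution μ ρ α T y)
    (h' : IsMaximalSolution μ ρ α T' y') : T = T' ∧ ∀ t ∈ lifespan T, y t = y' t := by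
  have hT : T = T' := le_antisymm (h'.maximal T y h.sol h.start) (h.maximal T' y' h'.sol h'.start)
  subst hT
  exact ⟨rfl, fun t ht => h.sol.eq_of_initial_eq (contDiff_samField h0 hμ hρ).locallyLipschitz
    h'.sol (h.start.trans h'.start.symm) ht ht⟩

/-- A maximal solution whose center stays away from `0` is global. -/
theorem IsMaximalSolution.eq_top_of_le_logCenter (h0 : 0 < μ 0) (hμ : StrictMono μ) (hρ : 0 < ρ)
    {T : EReal} {y : ℝ → Fin (k + 2) → ℝ} (h : IsMaximalSolution μ ρ α T y) {c : ℝ} (hc : 0 < c)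
    (hle : ∀ t ∈ lifespan T, c ≤ logCenter μ ρ (y t)) : T = ⊤ := by
  by_contra hT
  obtain ⟨b, rfl⟩ : ∃ b : ℝ, T = b :=
    ⟨T.toReal, (EReal.coe_toReal hT (h.pos.trans' EReal.bot_lt_zero).ne').symm⟩
  have hb : 0 < b := by exact_mod_cast h.pos
  have hinv : ∀ t ∈ lifespan (b : EReal), invCenter μ ρ (y t) ≤ (2 * c)⁻¹ := fun t ht => by
    have := hle t ht
    unfold invCenter
    gcongr
  -- The cut-off 1/c lies strictly above the a priori bound 1/(2c), which leaves room to continue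
  -- past b with the cut-off inactive.
  have hC : (2 * c)⁻¹ < c⁻¹ := by
    gcongr; linarith
  obtain ⟨B, hB⟩ := exists_norm_truncField_le h0 hμ hρ (C := c⁻¹) (by positivity)
  obtain ⟨Y, hY, -⟩ := exists_lipschitz_flow (locallyLipschitz_truncField h0 hμ hρ c⁻¹) hB
    (fun _ => Real.log α) 0 ⟨b + 1, by positivity⟩
  obtain ⟨hz0, hz⟩ := hY (fun _ => Real.log α) (by simp)
  set z := Y fun _ => Real.log α with hzdef
  replace hz : IsSolution (truncField μ ρ c⁻¹) ((b + 1 : ℝ) : EReal) z := hz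
  have hyt : IsSolution (truncField μ ρ c⁻¹) b y := h.sol.congr_field fun t ht => by
    rw [truncField, min_eq_left ((hinv t ht).trans hC.le), samField]
  have hsub : ∀ t ∈ lifespan (b : EReal), t ∈ lifespan ((b + 1 : ℝ) : EReal) := fun t ht => by
    rw [mem_lifespan_coe] at ht ⊢
    exact ⟨ht.1, by linarith⟩
  have hyz : ∀ t ∈ lifespan (b : EReal), y t = z t := fun t ht =>
    hyt.eq_of_initial_eq (locallyLipschitz_truncField h0 hμ hρ c⁻¹) hz (h.start.trans hz0.symm) ht
      (hsub t ht)
  have hbmem : b ∈ lifespan ((b + 1 : ℝ) : EReal) := mem_lifespan_coe.2 ⟨hb.le, by linarith⟩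
  have hcont : ContinuousAt (fun t => invCenter μ ρ (z t)) b :=
    (contDiff_invCenter h0 hμ hρ).continuous.continuousAt.comp
      ((hz b hbmem).hasDerivAt (Ici_mem_nhds hb)).continuousAt
  have hzb : invCenter μ ρ (z b) ≤ (2 * c)⁻¹ := by
    refine le_of_tendsto (hcont.tendsto.mono_left (nhdsWithin_le_nhds (s := Iio b))) ?_
    filter_upwards [Ioo_mem_nhdsLT hb] with t ht
    have ht' := mem_lifespan_coe.2 ⟨ht.1.le, ht.2⟩
    rw [← hyz t ht']
    exact hinv t ht'
  obtain ⟨ε, hε, hball⟩ := Metric.eventually_nhds_iff.1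
    (hcont.eventually (gt_mem_nhds (hzb.trans_lt hC)))
  set e := min ε 1 with he
  have he0 : 0 < e := lt_min hε one_pos
  -- The truncated solution satisfies the bound at b by continuity, so it stays below the cut-off a
  -- little longer and solves the true equation beyond b, against maximality.
  have hsol : IsSolution (samField μ ρ) ((b + e : ℝ) : EReal) z := by
    have hbe : b + e ≤ b + 1 := by linarith [min_le_right ε 1]
    refine (hz.mono (by exact_mod_cast hbe)).congr_field fun t ht => ?_
    rw [mem_lifespan_coe] at ht
    have : invCenter μ ρ (z t) ≤ c⁻¹ := by
      rcases lt_or_ge t b with htb | htb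
      · have ht' := mem_lifespan_coe.2 ⟨ht.1, htb⟩
        rw [← hyz t ht']
        exact (hinv t ht').trans hC.le
      · refine (hball ?_).le
        rw [Real.dist_eq, abs_of_nonneg (by linarith)]
        linarith [min_le_left ε 1]
    rw [truncField, min_eq_left this, samField]
  have := h.maximal _ z hsol hz0
  have : b + e ≤ b := by exact_mod_cast this
  linarith

/-- Maximal solutions depend continuously on the initial scale. -/
theorem IsMaximalSolution.eventually_mem (h0 : 0 < μ 0) (hμ : StrictMono μ) (hρ : 0 < ρ)
    (hα : 0 < α) {T : EReal} {y : ℝ → Fin (k + 2) → ℝ} (h : IsMaximalSolution μ ρ α T y) {t : ℝ}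
    (ht : t ∈ lifespan T) {U : Set (Fin (k + 2) → ℝ)} (hU : U ∈ 𝓝 (y t)) :
    ∀ᶠ α' in 𝓝 α, ∀ T' y', IsMaximalSolution μ ρ α' T' y' → t ∈ lifespan T' ∧ y' t ∈ U := by
  obtain ⟨t₁, ht₁, hlt⟩ := exists_lt_mem_lifespan ht
  have hsub : ∀ s ∈ Icc 0 t₁, s ∈ lifespan T := fun s hs => mem_lifespan_of_le hs.1 hs.2 ht₁
  have hK : IsCompact (y '' Icc 0 t₁) :=
    isCompact_Icc.image_of_continuousOn (h.sol.continuousOn.mono hsub)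
  have hic := (contDiff_invCenter h0 hμ hρ).continuous
  obtain ⟨C₀, hC₀⟩ := (hK.image hic).bddAbove
  -- Strictly above 1/(2 m_c) on the compact arc, so truncation changes nothing on a whole
  -- δ-neighbourhood of the arc.
  set C := max C₀ 0 + 1 with hCdef
  have hC : 0 < C := by positivity
  have hKC : y '' Icc 0 t₁ ⊆ {p | invCenter μ ρ p < C} := by
    intro p hp
    have := hC₀ ⟨p, hp, rfl⟩
    have := le_max_left C₀ 0
    show invCenter μ ρ p < C
    linarith
  obtain ⟨δ, hδ, hthick⟩ :=
    hK.exists_thickening_subset_open (isOpen_lt hic continuous_const) hKC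
  obtain ⟨η, hη, hball⟩ := Metric.mem_nhds_iff.1 hU
  obtain ⟨B, hB⟩ := exists_norm_truncField_le h0 hμ hρ hC
  have hLip := locallyLipschitz_truncField h0 hμ hρ C
  obtain ⟨Y, hY, L, hL⟩ := exists_lipschitz_flow hLip hB (fun _ => Real.log α) 1 ⟨t₁, ht₁.1⟩
  replace hY : ∀ x ∈ closedBall (fun _ => Real.log α) (1 : ℝ≥0),
    Y x 0 = x ∧ IsSolution (truncField μ ρ C) (t₁ : EReal) (Y x) := hY
  replace hL : ∀ t ∈ lifespan (t₁ : EReal),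
    LipschitzOnWith L (Y · t) (closedBall (fun _ => Real.log α) (1 : ℝ≥0)) := hL
  have hx₀ : (fun _ => Real.log α) ∈ closedBall (fun _ : Fin (k + 2) => Real.log α) (1 : ℝ≥0) :=
    mem_closedBall_self (by positivity)
  have hYy : ∀ s ∈ lifespan (t₁ : EReal), Y (fun _ => Real.log α) s = y s := by
    intro s hs
    refine (hY _ hx₀).2.eq_of_initial_eq hLip (T' := t₁) (z := y) ?_
      ((hY _ hx₀).1.trans h.start.symm) hs hs
    refine (h.sol.mono ht₁.2.le).congr_field fun s hs => ?_
    obtain ⟨hs1, hs2⟩ := mem_lifespan_coe.1 hs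
    have : invCenter μ ρ (y s) < C := hKC ⟨s, ⟨hs1, hs2.le⟩, rfl⟩
    rw [truncField, min_eq_left this.le, samField]
  have hcont : Tendsto (fun α' => (L : ℝ) * dist (fun _ : Fin (k + 2) => Real.log α')
      (fun _ => Real.log α)) (𝓝 α) (𝓝 0) := by
    have h1 : ContinuousAt (fun α' => (fun _ : Fin (k + 2) => Real.log α')) α :=
      continuousAt_pi.2 fun _ => Real.continuousAt_log hα.ne'
    simpa using (tendsto_iff_dist_tendsto_zero.1 h1.tendsto).const_mul (L : ℝ)
  have hcont' : ∀ᶠ α' in 𝓝 α, (fun _ => Real.log α') ∈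
      closedBall (fun _ : Fin (k + 2) => Real.log α) (1 : ℝ≥0) := by
    have h1 : ContinuousAt (fun α' => (fun _ : Fin (k + 2) => Real.log α')) α :=
      continuousAt_pi.2 fun _ => Real.continuousAt_log hα.ne'
    exact h1.eventually (closedBall_mem_nhds _ (by norm_num))
  filter_upwards [hcont.eventually (gt_mem_nhds hδ), hcont.eventually (gt_mem_nhds hη), hcont']
    with α' h1 h2 h3 T' y' hy'
  have hd : ∀ s ∈ lifespan (t₁ : EReal), dist (Y (fun _ => Real.log α') s) (y s) ≤
      L * dist (fun _ : Fin (k + 2) => Real.log α') (fun _ => Real.log α) := fun s hs => by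
    rw [← hYy s hs]
    exact (hL s hs).dist_le_mul _ h3 _ hx₀
  -- Lipschitz dependence keeps the truncated solution from α' within δ of the arc, so it is a true
  -- solution; maximality then puts t in the lifespan at scale α'.
  have hsol : IsSolution (samField μ ρ) t₁ (Y fun _ => Real.log α') := by
    refine (hY _ h3).2.congr_field fun s hs => ?_
    obtain ⟨hs1, hs2⟩ := mem_lifespan_coe.1 hs
    have : invCenter μ ρ (Y (fun _ => Real.log α') s) < C :=
      hthick (mem_thickening_iff.2 ⟨y s, ⟨s, ⟨hs1, hs2.le⟩, rfl⟩, (hd s hs).trans_lt h1⟩)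
    rw [truncField, min_eq_left this.le, samField]
  have htt : t ∈ lifespan (t₁ : EReal) := mem_lifespan_coe.2 ⟨ht.1, hlt⟩
  have ht' : t ∈ lifespan T' := lifespan_mono (hy'.maximal _ _ hsol (hY _ h3).1) htt
  refine ⟨ht', hball ?_⟩
  rw [hy'.sol.eq_of_initial_eq (contDiff_samField h0 hμ hρ).locallyLipschitz hsol
    (hy'.start.trans (hY _ h3).1.symm) ht' htt]
  exact (hd t htt).trans_lt h2

end SAMFlow

end

noncomputable section

namespace SAMFlow

open Set Filter Topology Metric
open scoped Gradient NNReal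

variable {k : ℕ} {μ : Fin (k + 2) → ℝ} {ρ α : ℝ} {T : EReal} {y : ℝ → Fin (k + 2) → ℝ}

/-! ### One-way barriers and decay below the floor. -/

section Dynamics

/-- The rate at which the center moves away from the ceiling. -/
def centerRate (μ : Fin (k + 2) → ℝ) (ρ : ℝ) (y : Fin (k + 2) → ℝ) : ℝ :=
  gain μ (invCenter μ ρ y) y * logMoment μ 3 y / (2 * ρ ^ 2 * logCenter μ ρ y ^ 2)

theorem centerRate_pos (h0 : 0 < μ 0) (hμ : StrictMono μ) (hρ : 0 < ρ) (y : Fin (k + 2) → ℝ) :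
    0 < centerRate μ ρ y := by
  have h1 := gain_pos μ (invCenter μ ρ y) y
  have h2 := logMoment_pos h0 hμ 3 y
  have h3 := logCenter_pos h0 hμ hρ y
  unfold centerRate
  positivity

theorem IsSolution.hasDerivWithinAt_logCenter (h0 : 0 < μ 0) (hμ : StrictMono μ) (hρ : 0 < ρ)
    (h : IsSolution (samField μ ρ) T y) {t : ℝ} (ht : t ∈ lifespan T) :
    HasDerivWithinAt (fun t => logCenter μ ρ (y t))
      (centerRate μ ρ (y t) * (logCenter μ ρ (y t) - logCeiling μ (y t))) (Ici 0) t :=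
  SAMFlow.hasDerivWithinAt_logCenter h0 hμ hρ (h t ht)

theorem IsSolution.continuousOn_logCenter (h0 : 0 < μ 0) (hμ : StrictMono μ)
    (h : IsSolution (samField μ ρ) T y) :
    ContinuousOn (fun t => logCenter μ ρ (y t)) (lifespan T) :=
  (contDiff_logCenter h0 hμ ρ).continuous.comp_continuousOn h.continuousOn

theorem IsSolution.ceiling_lt_center (h0 : 0 < μ 0) (hμ : StrictMono μ) (hρ : 0 < ρ)
    (h : IsSolution (samField μ ρ) T y) {t₀ t : ℝ} (ht₀ : 0 ≤ t₀)
    (hle : logCeiling μ (y t₀) ≤ logCenter μ ρ (y t₀)) (ht : t ∈ lifespan T) (hlt : t₀ < t) :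
    logCeiling μ (y t) < logCenter μ ρ (y t) := by
  obtain ⟨D, hD⟩ := hasDerivWithinAt_center_sub_ceiling_pos h0 hμ hρ y
  exact sub_pos.1 (pos_of_nonneg_of_deriv_pos_of_eq_zero
    (f := fun t => logCenter μ ρ (y t) - logCeiling μ (y t)) (f' := D)
    (fun t ht => (hD _ t (h t ht)).1) (fun t ht => (hD _ t (h t ht)).2) ht₀ (sub_nonneg.2 hle)
    ht hlt)

/-- On the floor the center lies strictly below the ceiling and therefore strictly decreases; even
touching the floor leads below it at once. -/
theorem IsSolution.center_lt_floor (h0 : 0 < μ 0) (hμ : StrictMono μ) (hρ : 0 < ρ)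
    (h : IsSolution (samField μ ρ) T y) {t₀ t : ℝ} (ht₀ : 0 ≤ t₀)
    (hle : logCenter μ ρ (y t₀) ≤ mL μ) (ht : t ∈ lifespan T) (hlt : t₀ < t) :
    logCenter μ ρ (y t) < mL μ := by
  refine sub_pos.1 (pos_of_nonneg_of_deriv_pos_of_eq_zero
    (f := fun t => mL μ - logCenter μ ρ (y t))
    (fun t ht => (h.hasDerivWithinAt_logCenter h0 hμ hρ ht).const_sub (mL μ)) (fun t ht hz => ?_)
    ht₀ (sub_nonneg.2 hle) ht hlt)
  have h1 := floor_lt_logCeiling h0 hμ (y t)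
  rw [neg_pos]
  exact mul_neg_of_pos_of_neg (centerRate_pos h0 hμ hρ _) (by linarith)

theorem IsSolution.strictMonoOn_logCenter (h0 : 0 < μ 0) (hμ : StrictMono μ) (hρ : 0 < ρ)
    (h : IsSolution (samField μ ρ) T y) {I : Set ℝ} (hI : Convex ℝ I) (hIT : I ⊆ lifespan T)
    (hlt : ∀ t ∈ interior I, logCeiling μ (y t) < logCenter μ ρ (y t)) :
    StrictMonoOn (fun t => logCenter μ ρ (y t)) I :=
  strictMonoOn_of_hasDerivWithinAt_pos hI (hIT.trans (lifespan_subset_Ici T))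
    (fun _ ht => h.hasDerivWithinAt_logCenter h0 hμ hρ (hIT ht))
    fun t ht => mul_pos (centerRate_pos h0 hμ hρ _) (sub_pos.2 (hlt t ht))

theorem IsSolution.strictAntiOn_logCenter (h0 : 0 < μ 0) (hμ : StrictMono μ) (hρ : 0 < ρ)
    (h : IsSolution (samField μ ρ) T y) {I : Set ℝ} (hI : Convex ℝ I) (hIT : I ⊆ lifespan T)
    (hlt : ∀ t ∈ interior I, logCenter μ ρ (y t) < logCeiling μ (y t)) :
    StrictAntiOn (fun t => logCenter μ ρ (y t)) I :=
  strictAntiOn_of_hasDerivWithinAt_neg hI (hIT.trans (lifespan_subset_Ici T))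
    (fun _ ht => h.hasDerivWithinAt_logCenter h0 hμ hρ (hIT ht))
    fun t ht => mul_neg_of_pos_of_neg (centerRate_pos h0 hμ hρ _) (sub_neg.2 (hlt t ht))

/-- Below the floor all coefficients decay exponentially. -/
theorem IsSolution.expDecayOn (h0 : 0 < μ 0) (hμ : StrictMono μ) (hρ : 0 < ρ)
    (h : IsSolution (samField μ ρ) T y) {t₀ : ℝ} (ht₀ : t₀ ∈ lifespan T)
    (hlt : logCenter μ ρ (y t₀) < mL μ) (j : Fin (k + 2)) :
    ExpDecayOn (fun t => Real.exp (2 * y t j)) (lifespan T ∩ Ici t₀) := by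
  set I := lifespan T ∩ Ici t₀ with hI
  have hIc : Convex ℝ I := (convex_lifespan T).inter (convex_Ici t₀)
  have hIT : I ⊆ lifespan T := inter_subset_left
  have hfloor : ∀ t ∈ I, logCenter μ ρ (y t) < mL μ := fun t ht =>
    (eq_or_lt_of_le (show t₀ ≤ t from ht.2)).elim (fun e => e ▸ hlt)
      fun hl => h.center_lt_floor h0 hμ hρ ht₀.1 hlt.le ht.1 hl
  have hanti := (h.strictAntiOn_logCenter h0 hμ hρ hIc hIT fun t ht =>
    (hfloor t (interior_subset ht)).trans (floor_lt_logCeiling h0 hμ _)).antitoneOn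
  set m₀ := logCenter μ ρ (y t₀) with hm₀
  have hm₀pos : 0 < m₀ := logCenter_pos h0 hμ hρ _
  have hle : ∀ t ∈ I, logCenter μ ρ (y t) ≤ m₀ := fun t ht => hanti ⟨ht₀, mem_Ici.2 le_rfl⟩ ht ht.2
  obtain ⟨c, hc, hgain⟩ := exists_le_gain h0 hμ hρ m₀
  -- The center only decreases after t₀, so μ_j r ≥ μ_1/(2 m₀) = q > 1 from then on for every j;
  -- with the lower bound on the gain this gives a uniform negative rate.
  set q := μ 0 * (2 * m₀)⁻¹ with hq
  have hq1 : 1 < q := by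
    rw [hq, ← div_eq_mul_inv, one_lt_div (by positivity)]
    rw [mL] at hlt; linarith
  set κ := c * (μ 0 * (q - 1)) with hκ
  have hκpos : 0 < κ := mul_pos hc (mul_pos h0 (by linarith))
  have hfield : ∀ t ∈ I, samField μ ρ (y t) j ≤ -κ := by
    intro t ht
    have hmt := logCenter_pos h0 hμ hρ (y t)
    have hj := feature_pos h0 hμ j
    have hj0 : μ 0 ≤ μ j := hμ.monotone (Fin.zero_le j)
    have hr : (2 * m₀)⁻¹ ≤ invCenter μ ρ (y t) := by
      have := hle t ht
      unfold invCenter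
      gcongr
    have h1 : q ≤ μ j * invCenter μ ρ (y t) := mul_le_mul hj0 hr (by positivity) hj.le
    have h2 : κ ≤ gain μ (invCenter μ ρ (y t)) (y t) * (μ j * (μ j * invCenter μ ρ (y t) - 1)) := by
      have := hgain _ (hle t ht)
      have hq0 : 0 ≤ q - 1 := by linarith
      have hg := (gain_pos μ (invCenter μ ρ (y t)) (y t)).le
      rw [hκ]
      gcongr
    rw [samField, logField]
    linarith
  have hmono : MonotoneOn (fun t => -y t j - κ * t) I := by
    refine monotoneOn_of_hasDerivWithinAt_nonneg hIc (hIT.trans (lifespan_subset_Ici T))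
      (f' := fun t => -samField μ ρ (y t) j - κ) (fun t ht => ?_)
      fun t ht => by linarith [hfield t ht]
    have hyj := hasDerivWithinAt_pi.1 (h t (hIT ht)) j
    simpa using hyj.fun_neg.fun_sub ((hasDerivWithinAt_id t (Ici 0)).const_mul κ)
  refine ⟨fun t _ => Real.exp_pos _, 2 * κ, by positivity, fun s hs t ht hst => ?_⟩
  have := hmono hs ht hst
  simp only at this
  rw [← Real.exp_add]
  exact Real.exp_le_exp.2 (by linarith)

end Dynamics

/-! ### Two trapped trajectories cannot coexist. -/

section Comparison

/-- The center is increasing in every weight and homogeneous of degree one in the weights. -/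
theorem logCenter_le_of_le_sub (h0 : 0 < μ 0) (hμ : StrictMono μ) (hρ : 0 < ρ)
    {y z : Fin (k + 2) → ℝ} {l : ℝ} (h : ∀ j, y j ≤ z j - l) :
    logCenter μ ρ y ≤ Real.exp (-l) * logCenter μ ρ z := by
  have hy := logCenter_pos h0 hμ hρ y
  have hz := logCenter_pos h0 hμ hρ z
  refine le_of_sq_le_sq ?_ (by positivity)
  have hA : logMoment μ 2 y ≤ Real.exp (-l) ^ 2 * logMoment μ 2 z := by
    rw [logMoment, logMoment, Finset.mul_sum]
    refine Finset.sum_le_sum fun j _ => ?_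
    have e : Real.exp (-l) ^ 2 * (μ j ^ 2 * Real.exp (2 * z j)) =
        μ j ^ 2 * Real.exp (2 * (z j - l)) := by
      rw [← Real.exp_nat_mul, mul_left_comm, ← Real.exp_add]
      congr 2; push_cast; ring
    rw [e]
    have := h j
    gcongr
  rw [← logCenter_sq h0 hμ hρ y, ← logCenter_sq h0 hμ hρ z] at hA
  have hρ2 : 0 < 2 * ρ ^ 2 := by positivity
  refine le_of_mul_le_mul_left ?_ hρ2
  rw [mul_pow]
  linarith

/-- A global solution stays in a two-parameter family of weights. -/
theorem IsSolution.exists_planar (h0 : 0 < μ 0) (hμ : StrictMono μ)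
    (h : IsSolution (samField μ ρ) ⊤ y) (hstart : y 0 = fun _ => Real.log α) :
    ∃ s R : ℝ → ℝ, s 0 = 0 ∧ R 0 = 0 ∧ (∀ t, 0 ≤ t → ∀ j,
        y t j = Real.log α + μ j * s t - μ j ^ 2 * R t) ∧
      (∀ t, 0 ≤ t → HasDerivWithinAt s (gain μ (invCenter μ ρ (y t)) (y t)) (Ici 0) t) ∧
      ∀ t, 0 ≤ t → HasDerivWithinAt R
        (gain μ (invCenter μ ρ (y t)) (y t) * invCenter μ ρ (y t)) (Ici 0) t := by
  have h01 : μ 0 < μ 1 := hμ Fin.zero_lt_one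
  have h1 : 0 < μ 1 := h0.trans h01
  have h10 : μ 1 - μ 0 ≠ 0 := by linarith
  have hj : ∀ t, 0 ≤ t → ∀ j, HasDerivWithinAt (fun t => y t j)
      (gain μ (invCenter μ ρ (y t)) (y t) * (μ j * (1 - μ j * invCenter μ ρ (y t)))) (Ici 0) t :=
    fun t ht j => hasDerivWithinAt_pi.1 (h t (mem_lifespan_top.2 ht)) j
  -- The desired form says (y_j - log α)/μ_j = s - μ_j R; the coordinates 0 and 1 determine `s` and
  -- `R`, so nothing has to be integrated.
  set R : ℝ → ℝ := fun t => ((y t 0 - Real.log α) / μ 0 - (y t 1 - Real.log α) / μ 1) /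
    (μ 1 - μ 0) with hR
  set s : ℝ → ℝ := fun t => (y t 0 - Real.log α) / μ 0 + μ 0 * R t with hs
  have hRd : ∀ t, 0 ≤ t → HasDerivWithinAt R
      (gain μ (invCenter μ ρ (y t)) (y t) * invCenter μ ρ (y t)) (Ici 0) t := fun t ht => by
    refine (((((hj t ht 0).sub_const (Real.log α)).div_const (μ 0)).fun_sub
      (((hj t ht 1).sub_const (Real.log α)).div_const (μ 1))).div_const (μ 1 - μ 0)).congr_deriv ?_
    field_simp
    ring
  have hsd : ∀ t, 0 ≤ t → HasDerivWithinAt s (gain μ (invCenter μ ρ (y t)) (y t)) (Ici 0) t :=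
    fun t ht => by
    refine ((((hj t ht 0).sub_const (Real.log α)).div_const (μ 0)).fun_add
      ((hRd t ht).const_mul (μ 0))).congr_deriv ?_
    field_simp
    ring
  have hR0 : R 0 = 0 := by simp [hR, hstart]
  have hs0 : s 0 = 0 := by simp [hs, hstart, hR0]
  refine ⟨s, R, hs0, hR0, fun t ht j => ?_, hsd, hRd⟩
  have hd : ∀ t, 0 ≤ t →
      HasDerivWithinAt (fun t => y t j - μ j * s t + μ j ^ 2 * R t) 0 (Ici 0) t := fun t ht => by
    refine (((hj t ht j).fun_sub ((hsd t ht).const_mul (μ j))).fun_add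
      ((hRd t ht).const_mul (μ j ^ 2))).congr_deriv ?_
    ring
  have hconst := constant_of_has_deriv_right_zero
    (f := fun t => y t j - μ j * s t + μ j ^ 2 * R t) (a := 0) (b := t)
    (fun x hx => (hd x hx.1).continuousWithinAt.mono fun z hz => hz.1)
    (fun x hx => (hd x hx.1).mono fun z hz => hx.1.trans hz) t ⟨ht, le_rfl⟩
  simp only [hs0, hR0, hstart] at hconst
  linarith

/-- Two solutions that stay between the floor and the ceiling cannot start at different scales. -/
theorem not_lt_of_trapped (h0 : 0 < μ 0) (hμ : StrictMono μ) (hρ : 0 < ρ) {α' : ℝ}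
    {y' : ℝ → Fin (k + 2) → ℝ} (hα : 0 < α) (hlt : α < α')
    (h : IsSolution (samField μ ρ) ⊤ y) (hstart : y 0 = fun _ => Real.log α)
    (hL : ∀ t, 0 ≤ t → mL μ < logCenter μ ρ (y t))
    (hH : ∀ t, 0 ≤ t → logCenter μ ρ (y t) < logCeiling μ (y t))
    (h' : IsSolution (samField μ ρ) ⊤ y') (hstart' : y' 0 = fun _ => Real.log α')
    (hH' : ∀ t, 0 ≤ t → logCenter μ ρ (y' t) < logCeiling μ (y' t)) : False := by
  have hbound : ∀ {z : ℝ → Fin (k + 2) → ℝ}, IsSolution (samField μ ρ) ⊤ z →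
      (∀ t, 0 ≤ t → logCenter μ ρ (z t) < logCeiling μ (z t)) →
      ∀ t, 0 ≤ t → logCenter μ ρ (z t) ≤ logCenter μ ρ (z 0) := by
    intro z hz hzH t ht
    refine (hz.strictAntiOn_logCenter h0 hμ hρ (convex_Ici 0)
      (fun t ht => mem_lifespan_top.2 ht) fun t ht => hzH t ?_).antitoneOn (mem_Ici.2 le_rfl) ht ht
    exact interior_subset ht
  obtain ⟨c, hc, hg⟩ := exists_le_gain h0 hμ hρ (logCenter μ ρ (y 0))
  obtain ⟨c', hc', hg'⟩ := exists_le_gain h0 hμ hρ (logCenter μ ρ (y' 0))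
  obtain ⟨s, R, hs0, hR0, hy, hsd, hRd⟩ := h.exists_planar h0 hμ hstart
  obtain ⟨s', R', hs0', hR0', hy', hsd', hRd'⟩ := h'.exists_planar h0 hμ hstart'
  obtain ⟨τ, hτ, -⟩ := exists_inverse_of_deriv_ge hc hs0 hsd
    fun t ht => hg _ (hbound h hH t ht)
  obtain ⟨σ, hσ, hσl⟩ := exists_inverse_of_deriv_ge hc' hs0' hsd'
    fun t ht => hg' _ (hbound h' hH' t ht)
  have hspos : ∀ t, 0 ≤ t → 0 ≤ s t := fun t ht => by
    rw [← hs0]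
    exact monotoneOn_of_hasDerivWithinAt_nonneg (convex_Ici 0) subset_rfl hsd
      (fun t _ => (gain_pos _ _ _).le) (mem_Ici.2 le_rfl) ht ht
  set l := Real.log α' - Real.log α with hl
  have hlpos : 0 < l := sub_pos.2 (Real.log_lt_log hα hlt)
  -- `σ (s t)` is the time at which the second solution shows the same clock value as the first at
  -- t. At equal clocks the solutions differ only by the shift l and by μ_j² D.
  set D : ℝ → ℝ := fun t => R t - R' (σ (s t)) with hD
  have hDd : ∀ t ∈ lifespan ⊤, HasDerivWithinAt D (gain μ (invCenter μ ρ (y t)) (y t) *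
      (invCenter μ ρ (y t) - invCenter μ ρ (y' (σ (s t))))) (Ici 0) t := by
    intro t ht
    rw [mem_lifespan_top] at ht
    obtain ⟨h1, h2, h3⟩ := hσ _ (hspos t ht)
    have hcomp := (hRd' _ h1).comp t (h3.comp_hasDerivWithinAt t (hsd t ht))
      fun x hx => (hσ _ (hspos x hx)).1
    refine ((hRd t ht).fun_sub hcomp).congr_deriv ?_
    have := (gain_pos μ (invCenter μ ρ (y' (σ (s t)))) (y' (σ (s t)))).ne'
    field_simp
  have hrel : ∀ t, 0 ≤ t → ∀ j, y t j = y' (σ (s t)) j - l - μ j ^ 2 * D t := by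
    intro t ht j
    obtain ⟨h1, h2, -⟩ := hσ _ (hspos t ht)
    rw [hy t ht j, hy' _ h1 j, h2, hD, hl]
    ring
  have hDnn : ∀ t, 0 ≤ t → 0 ≤ D t := by
    have hD0 : D 0 = 0 := by
      have : σ 0 = 0 := by simpa [hs0'] using hσl 0 le_rfl
      simp [hD, hs0, hR0, this, hR0']
    intro t ht
    rcases ht.eq_or_lt with rfl | htpos
    · exact hD0.ge
    refine (pos_of_nonneg_of_deriv_pos_of_eq_zero hDd (fun t ht hz => ?_) le_rfl hD0.ge
      (mem_lifespan_top.2 ht) htpos).le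
    refine mul_pos (gain_pos _ _ _) (sub_pos.2 ?_)
    have hle := logCenter_le_of_le_sub h0 hμ hρ (y := y t) (z := y' (σ (s t))) (l := l)
      fun j => by rw [hrel t ht.1 j, hz]; simp
    have hpos := logCenter_pos h0 hμ hρ (y t)
    have hpos' := logCenter_pos h0 hμ hρ (y' (σ (s t)))
    have hexp : Real.exp (-l) < 1 := by simpa using hlpos
    have : logCenter μ ρ (y t) < logCenter μ ρ (y' (σ (s t))) := hle.trans_lt (by nlinarith)
    unfold invCenter
    gcongr
  -- Every time x of the upper solution is reached: the clock of the lower one is onto [0, ∞), so `τ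
  -- (s' x)` is the matching time, and the floor bound there transfers.
  have hm' : ∀ x, 0 ≤ x → mL μ ≤ Real.exp (-l) * logCenter μ ρ (y' x) := by
    intro x hx
    have hsx : 0 ≤ s' x := by
      rw [← hs0']
      exact monotoneOn_of_hasDerivWithinAt_nonneg (convex_Ici 0) subset_rfl hsd'
        (fun t _ => (gain_pos _ _ _).le) (mem_Ici.2 le_rfl) hx hx
    obtain ⟨ht, hst, -⟩ := hτ _ hsx
    have hσx : σ (s (τ (s' x))) = x := by rw [hst, hσl x hx]
    refine (hL _ ht).le.trans (logCenter_le_of_le_sub h0 hμ hρ fun j => ?_)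
    rw [hrel _ ht j, hσx]
    have := mul_nonneg (sq_nonneg (μ j)) (hDnn _ ht)
    linarith
  -- The improved bound gives μ_1 r ≤ e^{-l}, so y'_0 grows at least at this rate.
  set κ := c' * (μ 0 * (1 - Real.exp (-l))) with hκ
  have hexp : Real.exp (-l) < 1 := by simpa using hlpos
  have hκpos : 0 < κ := mul_pos hc' (mul_pos h0 (by linarith))
  have hgrow : MonotoneOn (fun t => y' t 0 - κ * t) (Ici 0) := by
    refine monotoneOn_of_hasDerivWithinAt_nonneg (convex_Ici 0) subset_rfl
      (f' := fun t => samField μ ρ (y' t) 0 - κ) (fun t ht => ?_) fun t ht => ?_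
    · have hyj := hasDerivWithinAt_pi.1 (h' t (mem_lifespan_top.2 ht)) 0
      simpa using hyj.fun_sub ((hasDerivWithinAt_id t (Ici 0)).const_mul κ)
    · have hmt := hm' t ht
      have hpos := logCenter_pos h0 hμ hρ (y' t)
      have h1 : μ 0 * invCenter μ ρ (y' t) ≤ Real.exp (-l) := by
        rw [invCenter, ← div_eq_mul_inv, div_le_iff₀ (by positivity)]
        rw [mL] at hmt; linarith
      have h2 := hg' _ (hbound h' hH' t ht)
      have : κ ≤ samField μ ρ (y' t) 0 := by
        have h3 : 0 ≤ 1 - Real.exp (-l) := by linarith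
        have h5 := (gain_pos μ (invCenter μ ρ (y' t)) (y' t)).le
        have h4 : 1 - Real.exp (-l) ≤ 1 - μ 0 * invCenter μ ρ (y' t) := by linarith
        rw [hκ, samField, logField]
        gcongr
      linarith
  -- The trapped center never exceeds its initial value, so A_2 ≤ Q; since 2 y'_0 ≤ exp (2 y'_0),
  -- this caps the linear growth.
  set Q := 2 * ρ ^ 2 * logCenter μ ρ (y' 0) ^ 2 with hQ
  have hup : ∀ t, 0 ≤ t → μ 0 ^ 2 * (2 * y' t 0) ≤ Q := by
    intro t ht
    have h1 := hbound h' hH' t ht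
    have hpos := logCenter_pos h0 hμ hρ (y' t)
    have h2 : logMoment μ 2 (y' t) ≤ Q := by
      rw [← logCenter_sq h0 hμ hρ, hQ]
      gcongr
    have h3 : μ 0 ^ 2 * Real.exp (2 * y' t 0) ≤ logMoment μ 2 (y' t) :=
      Finset.single_le_sum (f := fun j => μ j ^ 2 * Real.exp (2 * y' t j))
        (fun j _ => by positivity) (Finset.mem_univ 0)
    have h4 : μ 0 ^ 2 * (2 * y' t 0) ≤ μ 0 ^ 2 * Real.exp (2 * y' t 0) := by
      gcongr
      linarith [Real.add_one_le_exp (2 * y' t 0)]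
    linarith
  obtain ⟨n, hn⟩ := exists_nat_gt ((Q / (2 * μ 0 ^ 2) - y' 0 0) / κ)
  have hn0 : (0 : ℝ) ≤ n := Nat.cast_nonneg n
  have h1 := hgrow (mem_Ici.2 le_rfl) (mem_Ici.2 hn0) hn0
  have h2 := hup n hn0
  rw [div_lt_iff₀ hκpos] at hn
  have h3 : Q / (2 * μ 0 ^ 2) < y' n 0 := by
    simp only [mul_zero, sub_zero] at h1
    linarith
  rw [div_lt_iff₀ (by positivity)] at h3
  linarith

end Comparison

end SAMFlow

end

noncomputable section

namespace SAMFlow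

open Set Filter Topology Metric
open scoped Gradient NNReal

variable {k : ℕ} {μ : Fin (k + 2) → ℝ} {ρ α : ℝ} {T : EReal} {y : ℝ → Fin (k + 2) → ℝ}

/-! ### Computing hitting times. -/

section HittingTime

theorem hittingTime_eq_top {P : ℝ → Prop} (h : ∀ t ∈ lifespan T, ¬P t) : hittingTime T P = ⊤ := by
  have : {t | t ∈ lifespan T ∧ P t} = ∅ := eq_empty_of_forall_notMem fun t ht => h t ht.1 ht.2
  rw [hittingTime, this, image_empty, sInf_empty]

theorem hittingTime_eq_coe {P : ℝ → Prop} {t₀ : ℝ} (ht₀ : t₀ ∈ lifespan T) (hP : P t₀)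
    (h : ∀ t ∈ lifespan T, P t → t₀ ≤ t) : hittingTime T P = t₀ := by
  refine IsLeast.csInf_eq ⟨⟨t₀, ⟨ht₀, hP⟩, rfl⟩, ?_⟩
  rintro _ ⟨t, ⟨ht, hPt⟩, rfl⟩
  exact EReal.coe_le_coe_iff.2 (h t ht hPt)

end HittingTime

/-! ### Thresholds on α as positions of the initial center. -/

section InitialValues

theorem norm2_pos (h0 : 0 < μ 0) (hμ : StrictMono μ) : 0 < norm2 μ :=
  Real.sqrt_pos.2 (Finset.sum_pos (fun j _ => pow_pos (feature_pos h0 hμ j) 2)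
    Finset.univ_nonempty)

theorem sum_pow_pos (h0 : 0 < μ 0) (hμ : StrictMono μ) (n : ℕ) : 0 < ∑ j, μ j ^ n :=
  Finset.sum_pos (fun j _ => pow_pos (feature_pos h0 hμ j) n) Finset.univ_nonempty

theorem logMoment_log (μ : Fin (k + 2) → ℝ) (hα : 0 < α) (n : ℕ) :
    logMoment μ n (fun _ => Real.log α) = α ^ 2 * ∑ j, μ j ^ n := by
  rw [logMoment, Finset.mul_sum]
  refine Finset.sum_congr rfl fun j _ => ?_
  rw [two_mul, Real.exp_add, Real.exp_log hα]
  ring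

theorem logCenter_log (μ : Fin (k + 2) → ℝ) (ρ : ℝ) (hα : 0 < α) :
    logCenter μ ρ (fun _ => Real.log α) = α * (Real.sqrt 2 * norm2 μ) / (2 * ρ) := by
  rw [logCenter, logMoment_log μ hα, norm2, Real.sqrt_mul zero_le_two,
    Real.sqrt_mul (sq_nonneg α), Real.sqrt_sq hα.le]
  ring

theorem logCeiling_log (μ : Fin (k + 2) → ℝ) (hα : 0 < α) :
    logCeiling μ (fun _ => Real.log α) = (∑ j, μ j ^ 4) / (∑ j, μ j ^ 3) / 2 := by
  rw [logCeiling, logMoment_log μ hα, logMoment_log μ hα]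
  field_simp

/-- The initial center is linear in α, and all three thresholds have this form: x = μ_1 for the
floor, x = ‖μ‖₄⁴/‖μ‖₃³ for the ceiling, which at time 0 does not depend on α, and x = μ_{d-1} + μ_d.
-/
theorem lt_scale_iff (h0 : 0 < μ 0) (hμ : StrictMono μ) (hρ : 0 < ρ) (hα : 0 < α) (x : ℝ) :
    α < ρ * x / (Real.sqrt 2 * norm2 μ) ↔ logCenter μ ρ (fun _ => Real.log α) < x / 2 := by
  have := norm2_pos h0 hμ
  rw [logCenter_log μ ρ hα, lt_div_iff₀ (by positivity), div_lt_div_iff₀ (by positivity) two_pos]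
  constructor <;> intro h <;> linarith

theorem scale_lt_iff (h0 : 0 < μ 0) (hμ : StrictMono μ) (hρ : 0 < ρ) (hα : 0 < α) (x : ℝ) :
    ρ * x / (Real.sqrt 2 * norm2 μ) < α ↔ x / 2 < logCenter μ ρ (fun _ => Real.log α) := by
  have := norm2_pos h0 hμ
  rw [logCenter_log μ ρ hα, div_lt_iff₀ (by positivity), div_lt_div_iff₀ two_pos (by positivity)]
  constructor <;> intro h <;> linarith

theorem alphaH_eq (μ : Fin (k + 2) → ℝ) (ρ : ℝ) : alphaH μ ρ =
    ρ * ((∑ j, μ j ^ 4) / ∑ j, μ j ^ 3) / (Real.sqrt 2 * norm2 μ) := by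
  rw [alphaH, mul_div_assoc', div_div, mul_comm (∑ j, μ j ^ 3)]

theorem lt_alpha0_iff (h0 : 0 < μ 0) (hμ : StrictMono μ) (hρ : 0 < ρ) (hα : 0 < α) :
    α < alpha0 μ ρ ↔ logCenter μ ρ (fun _ => Real.log α) < mL μ :=
  lt_scale_iff h0 hμ hρ hα _

theorem alpha0_lt_iff (h0 : 0 < μ 0) (hμ : StrictMono μ) (hρ : 0 < ρ) (hα : 0 < α) :
    alpha0 μ ρ < α ↔ mL μ < logCenter μ ρ (fun _ => Real.log α) :=
  scale_lt_iff h0 hμ hρ hα _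

theorem lt_alphaH_iff (h0 : 0 < μ 0) (hμ : StrictMono μ) (hρ : 0 < ρ) (hα : 0 < α) :
    α < alphaH μ ρ ↔
      logCenter μ ρ (fun _ => Real.log α) < logCeiling μ (fun _ => Real.log α) := by
  rw [alphaH_eq, logCeiling_log μ hα]
  exact lt_scale_iff h0 hμ hρ hα _

theorem alphaH_lt_iff (h0 : 0 < μ 0) (hμ : StrictMono μ) (hρ : 0 < ρ) (hα : 0 < α) :
    alphaH μ ρ < α ↔
      logCeiling μ (fun _ => Real.log α) < logCenter μ ρ (fun _ => Real.log α) := by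
  rw [alphaH_eq, logCeiling_log μ hα]
  exact scale_lt_iff h0 hμ hρ hα _

theorem lt_alpha2_iff (h0 : 0 < μ 0) (hμ : StrictMono μ) (hρ : 0 < ρ) (hα : 0 < α) :
    α < alpha2 μ ρ ↔ logCenter μ ρ (fun _ => Real.log α) < mTop μ :=
  lt_scale_iff h0 hμ hρ hα _

theorem alpha2_lt_iff (h0 : 0 < μ 0) (hμ : StrictMono μ) (hρ : 0 < ρ) (hα : 0 < α) :
    alpha2 μ ρ < α ↔ mTop μ < logCenter μ ρ (fun _ => Real.log α) :=
  scale_lt_iff h0 hμ hρ hα _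

theorem alpha0_pos (h0 : 0 < μ 0) (hμ : StrictMono μ) (hρ : 0 < ρ) : 0 < alpha0 μ ρ := by
  have := norm2_pos h0 hμ
  unfold alpha0; positivity

theorem alphaH_pos (h0 : 0 < μ 0) (hμ : StrictMono μ) (hρ : 0 < ρ) : 0 < alphaH μ ρ := by
  have := norm2_pos h0 hμ
  have := sum_pow_pos h0 hμ 3
  have := sum_pow_pos h0 hμ 4
  unfold alphaH; positivity

/-- The quotient ‖μ‖₄⁴/‖μ‖₃³ is a weighted mean of the features, at most μ_d, and μ_{d-1} > 0 makes
the comparison strict. -/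
theorem alphaH_lt_alpha2 (h0 : 0 < μ 0) (hμ : StrictMono μ) (hρ : 0 < ρ) :
    alphaH μ ρ < alpha2 μ ρ := by
  have hN := norm2_pos h0 hμ
  have h3 := sum_pow_pos h0 hμ 3
  rw [alphaH_eq, alpha2]
  have hle : (∑ j, μ j ^ 4) / (∑ j, μ j ^ 3) ≤ μ (Fin.last (k + 1)) := by
    rw [div_le_iff₀ h3, Finset.mul_sum]
    refine Finset.sum_le_sum fun j _ => ?_
    rw [pow_succ' _ 3]
    exact mul_le_mul_of_nonneg_right (hμ.monotone (Fin.le_last j))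
      (pow_nonneg (feature_pos h0 hμ j).le 3)
  have := feature_pos h0 hμ (Fin.last k).castSucc
  gcongr
  linarith

end InitialValues

/-! ### Falling, rising, and the boundary scale. -/

section Dichotomy

/-- Reaching the ceiling earlier would keep the center above it, hence above the floor, at time t;
later the center stays below the floor, hence below the ceiling. -/
theorem IsSolution.center_lt_ceiling_of_lt_floor (h0 : 0 < μ 0) (hμ : StrictMono μ) (hρ : 0 < ρ)
    (h : IsSolution (samField μ ρ) T y) {t : ℝ} (ht : t ∈ lifespan T)
    (hlt : logCenter μ ρ (y t) < mL μ) {s : ℝ} (hs : s ∈ lifespan T) :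
    logCenter μ ρ (y s) < logCeiling μ (y s) := by
  by_contra! hle
  have hf := floor_lt_logCeiling h0 hμ
  rcases lt_trichotomy s t with hst | hst | hst
  · linarith [h.ceiling_lt_center h0 hμ hρ hs.1 hle ht hst, hf (y t)]
  · subst hst; linarith [hf (y s)]
  · linarith [h.center_lt_floor h0 hμ hρ ht.1 hlt.le hs hst, hf (y s)]

theorem IsSolution.floor_lt_center_of_ceiling_le (h0 : 0 < μ 0) (hμ : StrictMono μ) (hρ : 0 < ρ)
    (h : IsSolution (samField μ ρ) T y) {t : ℝ} (ht : t ∈ lifespan T)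
    (hle : logCeiling μ (y t) ≤ logCenter μ ρ (y t)) {s : ℝ} (hs : s ∈ lifespan T) :
    mL μ < logCenter μ ρ (y s) := by
  by_contra! hs'
  obtain ⟨s', hs'm, hlt⟩ := exists_lt_mem_lifespan hs
  exact hle.not_gt (h.center_lt_ceiling_of_lt_floor h0 hμ hρ hs'm
    (h.center_lt_floor h0 hμ hρ hs.1 hs' hs'm hlt) ht)

theorem floor_pos (h0 : 0 < μ 0) : 0 < mL μ := half_pos h0

/-- The maximal solution from scale `α` falls below the floor. -/
def FallsBelowFloor (μ : Fin (k + 2) → ℝ) (ρ α : ℝ) : Prop :=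
  ∃ T y, IsMaximalSolution μ ρ α T y ∧ ∃ t ∈ lifespan T, logCenter μ ρ (y t) < mL μ

/-- The maximal solution from scale `α` rises above the ceiling. -/
def RisesAboveCeiling (μ : Fin (k + 2) → ℝ) (ρ α : ℝ) : Prop :=
  ∃ T y, IsMaximalSolution μ ρ α T y ∧ ∃ t ∈ lifespan T, logCeiling μ (y t) < logCenter μ ρ (y t)

theorem FallsBelowFloor.exists_lt (h0 : 0 < μ 0) (hμ : StrictMono μ) (hρ : 0 < ρ)
    (h : FallsBelowFloor μ ρ α) (hy : IsMaximalSolution μ ρ α T y) :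
    ∃ t ∈ lifespan T, logCenter μ ρ (y t) < mL μ := by
  obtain ⟨T', y', hy', t, ht, hlt⟩ := h
  obtain ⟨rfl, he⟩ := hy'.unique h0 hμ hρ hy
  exact ⟨t, ht, he t ht ▸ hlt⟩

theorem RisesAboveCeiling.exists_lt (h0 : 0 < μ 0) (hμ : StrictMono μ) (hρ : 0 < ρ)
    (h : RisesAboveCeiling μ ρ α) (hy : IsMaximalSolution μ ρ α T y) :
    ∃ t ∈ lifespan T, logCeiling μ (y t) < logCenter μ ρ (y t) := by
  obtain ⟨T', y', hy', t, ht, hlt⟩ := h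
  obtain ⟨rfl, he⟩ := hy'.unique h0 hμ hρ hy
  exact ⟨t, ht, he t ht ▸ hlt⟩

theorem FallsBelowFloor.not_risesAboveCeiling (h0 : 0 < μ 0) (hμ : StrictMono μ) (hρ : 0 < ρ)
    (h : FallsBelowFloor μ ρ α) : ¬RisesAboveCeiling μ ρ α := by
  rintro ⟨T, y, hy, t, ht, hlt⟩
  obtain ⟨s, hs, hlt'⟩ := h.exists_lt h0 hμ hρ hy
  exact lt_asymm hlt (hy.sol.center_lt_ceiling_of_lt_floor h0 hμ hρ hs hlt' ht)

/-- Falling is witnessed by a strict inequality at a single time, which survives small changes of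
the scale. -/
theorem FallsBelowFloor.eventually (h0 : 0 < μ 0) (hμ : StrictMono μ) (hρ : 0 < ρ) (hα : 0 < α)
    (h : FallsBelowFloor μ ρ α) : ∀ᶠ α' in 𝓝 α, FallsBelowFloor μ ρ α' := by
  obtain ⟨T, y, hy, t, ht, hlt⟩ := h
  filter_upwards [hy.eventually_mem h0 hμ hρ hα ht
    ((isOpen_lt (contDiff_logCenter h0 hμ ρ).continuous continuous_const).mem_nhds hlt)] with α' h'
  obtain ⟨T', y', hy'⟩ := exists_isMaximalSolution h0 hμ hρ α'
  exact ⟨T', y', hy', t, h' T' y' hy'⟩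

theorem RisesAboveCeiling.eventually (h0 : 0 < μ 0) (hμ : StrictMono μ) (hρ : 0 < ρ) (hα : 0 < α)
    (h : RisesAboveCeiling μ ρ α) : ∀ᶠ α' in 𝓝 α, RisesAboveCeiling μ ρ α' := by
  obtain ⟨T, y, hy, t, ht, hlt⟩ := h
  filter_upwards [hy.eventually_mem h0 hμ hρ hα ht
    ((isOpen_lt (continuous_logCeiling h0 hμ) (contDiff_logCenter h0 hμ ρ).continuous).mem_nhds
      hlt)] with α' h'
  obtain ⟨T', y', hy'⟩ := exists_isMaximalSolution h0 hμ hρ α'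
  exact ⟨T', y', hy', t, h' T' y' hy'⟩

theorem fallsBelowFloor_of_le_alpha0 (h0 : 0 < μ 0) (hμ : StrictMono μ) (hρ : 0 < ρ) (hα : 0 < α)
    (hle : α ≤ alpha0 μ ρ) : FallsBelowFloor μ ρ α := by
  obtain ⟨T, y, hy⟩ := exists_isMaximalSolution h0 hμ hρ α
  obtain ⟨t, ht, hlt⟩ := exists_lt_mem_lifespan (zero_mem_lifespan hy.pos)
  refine ⟨T, y, hy, t, ht, hy.sol.center_lt_floor h0 hμ hρ le_rfl ?_ ht hlt⟩
  rw [hy.start]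
  exact not_lt.1 fun hc => hle.not_gt ((alpha0_lt_iff h0 hμ hρ hα).2 hc)

theorem risesAboveCeiling_of_alphaH_le (h0 : 0 < μ 0) (hμ : StrictMono μ) (hρ : 0 < ρ)
    (hle : alphaH μ ρ ≤ α) : RisesAboveCeiling μ ρ α := by
  have hα := (alphaH_pos h0 hμ hρ).trans_le hle
  obtain ⟨T, y, hy⟩ := exists_isMaximalSolution h0 hμ hρ α
  obtain ⟨t, ht, hlt⟩ := exists_lt_mem_lifespan (zero_mem_lifespan hy.pos)
  refine ⟨T, y, hy, t, ht, hy.sol.ceiling_lt_center h0 hμ hρ le_rfl ?_ ht hlt⟩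
  rw [hy.start]
  exact not_lt.1 fun hc => hle.not_gt ((lt_alphaH_iff h0 hμ hρ hα).2 hc)

theorem IsMaximalSolution.eq_top_of_not_fallsBelowFloor (h0 : 0 < μ 0) (hμ : StrictMono μ)
    (hρ : 0 < ρ) (hy : IsMaximalSolution μ ρ α T y) (h : ¬FallsBelowFloor μ ρ α) : T = ⊤ :=
  hy.eq_top_of_le_logCenter h0 hμ hρ (floor_pos h0) fun t ht =>
    not_lt.1 fun hc => h ⟨T, y, hy, t, ht, hc⟩

/-- A trajectory that merely touches the floor or the ceiling has strictly crossed it at any later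
time, so excluding strict crossings gives strict bounds. -/
theorem IsMaximalSolution.trapped (h0 : 0 < μ 0) (hμ : StrictMono μ)
    (hρ : 0 < ρ) (hy : IsMaximalSolution μ ρ α T y) (hF : ¬FallsBelowFloor μ ρ α)
    (hC : ¬RisesAboveCeiling μ ρ α) {t : ℝ} (ht : t ∈ lifespan T) :
    mL μ < logCenter μ ρ (y t) ∧ logCenter μ ρ (y t) < logCeiling μ (y t) := by
  obtain ⟨s, hs, hlt⟩ := exists_lt_mem_lifespan ht
  constructor <;> by_contra! hle
  · exact hF ⟨T, y, hy, s, hs, hy.sol.center_lt_floor h0 hμ hρ ht.1 hle hs hlt⟩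
  · exact hC ⟨T, y, hy, s, hs, hy.sol.ceiling_lt_center h0 hμ hρ ht.1 hle hs hlt⟩

theorem not_lt_of_neither (h0 : 0 < μ 0) (hμ : StrictMono μ) (hρ : 0 < ρ) {α' : ℝ} (hα : 0 < α)
    (hF : ¬FallsBelowFloor μ ρ α) (hC : ¬RisesAboveCeiling μ ρ α)
    (hF' : ¬FallsBelowFloor μ ρ α') (hC' : ¬RisesAboveCeiling μ ρ α') : ¬α < α' := by
  intro hlt
  obtain ⟨T, y, hy⟩ := exists_isMaximalSolution h0 hμ hρ α
  obtain ⟨T', y', hy'⟩ := exists_isMaximalSolution h0 hμ hρ α'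
  obtain rfl := hy.eq_top_of_not_fallsBelowFloor h0 hμ hρ hF
  obtain rfl := hy'.eq_top_of_not_fallsBelowFloor h0 hμ hρ hF'
  have htr := fun t (ht : 0 ≤ t) => hy.trapped h0 hμ hρ hF hC (mem_lifespan_top.2 ht)
  have htr' := fun t (ht : 0 ≤ t) => hy'.trapped h0 hμ hρ hF' hC' (mem_lifespan_top.2 ht)
  exact not_lt_of_trapped h0 hμ hρ hα hlt hy.sol hy.start (fun t ht => (htr t ht).1)
    (fun t ht => (htr t ht).2) hy'.sol hy'.start fun t ht => (htr' t ht).2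

/-- On an interval of scales without a trapped trajectory, all trajectories behave alike. -/
theorem not_both_of_isPreconnected (h0 : 0 < μ 0) (hμ : StrictMono μ) (hρ : 0 < ρ) {I : Set ℝ}
    (hI : IsPreconnected I) (hpos : ∀ α ∈ I, 0 < α)
    (hcover : ∀ α ∈ I, FallsBelowFloor μ ρ α ∨ RisesAboveCeiling μ ρ α) {a b : ℝ} (ha : a ∈ I)
    (hb : b ∈ I) (hF : FallsBelowFloor μ ρ a) (hC : RisesAboveCeiling μ ρ b) : False := by
  have hopen : ∀ {P : ℝ → Prop}, (∀ α, 0 < α → P α → ∀ᶠ α' in 𝓝 α, P α') →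
      IsOpen {α | 0 < α ∧ P α} := fun hP => isOpen_iff_mem_nhds.2 fun α hα =>
    (eventually_gt_nhds hα.1).and (hP α hα.1 hα.2)
  obtain ⟨x, -, hx1, hx2⟩ := hI {α | 0 < α ∧ FallsBelowFloor μ ρ α}
    {α | 0 < α ∧ RisesAboveCeiling μ ρ α}
    (hopen fun α hα h => h.eventually h0 hμ hρ hα) (hopen fun α hα h => h.eventually h0 hμ hρ hα)
    (fun α hα => (hcover α hα).imp (fun h => ⟨hpos α hα, h⟩) fun h => ⟨hpos α hα, h⟩)
    ⟨a, ha, hpos a ha, hF⟩ ⟨b, hb, hpos b hb, hC⟩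
  exact hx1.2.not_risesAboveCeiling h0 hμ hρ hx2.2

/-- The positive scales are connected and contain both falling and rising ones, two disjoint open
conditions, so some scale is neither; comparison makes it unique. On each side of it the same
connectedness argument leaves a single behaviour, fixed by α₀ on the left and α_H on the right. -/
theorem exists_boundary_scale (h0 : 0 < μ 0) (hμ : StrictMono μ) (hρ : 0 < ρ) :
    ∃ α₁, alpha0 μ ρ < α₁ ∧ α₁ < alphaH μ ρ ∧ ¬FallsBelowFloor μ ρ α₁ ∧
      ¬RisesAboveCeiling μ ρ α₁ ∧
      (∀ α, 0 < α → ¬FallsBelowFloor μ ρ α → ¬RisesAboveCeiling μ ρ α → α = α₁) ∧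
      (∀ α, 0 < α → α < α₁ → FallsBelowFloor μ ρ α) ∧
      ∀ α, α₁ < α → RisesAboveCeiling μ ρ α := by
  have ha0 := alpha0_pos h0 hμ hρ
  have haH := alphaH_pos h0 hμ hρ
  have hF0 := fallsBelowFloor_of_le_alpha0 h0 hμ hρ ha0 le_rfl
  have hCH := risesAboveCeiling_of_alphaH_le h0 hμ hρ (le_refl (alphaH μ ρ))
  obtain ⟨α₁, hα₁, hF, hC⟩ :
      ∃ α, 0 < α ∧ ¬FallsBelowFloor μ ρ α ∧ ¬RisesAboveCeiling μ ρ α := by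
    by_contra! hno
    refine not_both_of_isPreconnected h0 hμ hρ isPreconnected_Ioi (fun α hα => hα)
      (fun α hα => ?_) (mem_Ioi.2 ha0) (mem_Ioi.2 haH) hF0 hCH
    by_cases hf : FallsBelowFloor μ ρ α
    · exact Or.inl hf
    · exact Or.inr (hno α hα hf)
  have huniq : ∀ α, 0 < α → ¬FallsBelowFloor μ ρ α → ¬RisesAboveCeiling μ ρ α → α = α₁ :=
    fun α hα hf hc => le_antisymm (not_lt.1 (not_lt_of_neither h0 hμ hρ hα₁ hF hC hf hc))
      (not_lt.1 (not_lt_of_neither h0 hμ hρ hα hf hc hF hC))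
  have hcover : ∀ α, 0 < α → α ≠ α₁ → FallsBelowFloor μ ρ α ∨ RisesAboveCeiling μ ρ α := by
    intro α hα hne
    by_contra! hno
    exact hne (huniq α hα hno.1 hno.2)
  have h01 : alpha0 μ ρ < α₁ :=
    not_le.1 fun hle => hF (fallsBelowFloor_of_le_alpha0 h0 hμ hρ hα₁ hle)
  have h1H : α₁ < alphaH μ ρ :=
    not_le.1 fun hle => hC (risesAboveCeiling_of_alphaH_le h0 hμ hρ hle)
  refine ⟨α₁, h01, h1H, hF, hC, huniq, fun α hα hlt => ?_, fun α hlt => ?_⟩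
  · refine (hcover α hα hlt.ne).resolve_right fun hc => ?_
    exact not_both_of_isPreconnected h0 hμ hρ (I := Ioo 0 α₁) isPreconnected_Ioo (fun α hα => hα.1)
      (fun α hα => hcover α hα.1 hα.2.ne) ⟨ha0, h01⟩ ⟨hα, hlt⟩ hF0 hc
  · refine (hcover α (hα₁.trans hlt) hlt.ne').resolve_left fun hf => ?_
    exact not_both_of_isPreconnected h0 hμ hρ (I := Ioi α₁) isPreconnected_Ioi
      (fun α hα => hα₁.trans hα) (fun α hα => hcover α (hα₁.trans hα) (ne_of_gt hα)) hlt h1H hf hCH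

end Dichotomy

end SAMFlow

end

noncomputable section

namespace SAMFlow

open Set Filter Topology Metric
open scoped Gradient NNReal

variable {k : ℕ} {μ : Fin (k + 2) → ℝ} {ρ α : ℝ} {T : EReal}

/-! ### The regimes, translated back to the weights. -/

section Regimes

variable {θ : ℝ → Params (k + 2)}

theorem ExpDecayOn.congr {f g : ℝ → ℝ} {I : Set ℝ} (h : ExpDecayOn f I)
    (hfg : ∀ t ∈ I, g t = f t) : ExpDecayOn g I := by
  obtain ⟨hpos, c, hc, hle⟩ := h
  refine ⟨fun t ht => hfg t ht ▸ hpos t ht, c, hc, fun s hs t ht hst => ?_⟩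
  rw [hfg s hs, hfg t ht]
  exact hle s hs t ht hst

theorem IsMaximalFlow.exists_logCoordinates (h0 : 0 < μ 0) (hμ : StrictMono μ) (hρ : 0 < ρ)
    (hα : 0 < α) (h : IsMaximalFlow μ ρ α T θ) :
    ∃ y, IsMaximalSolution μ ρ α T y ∧ (∀ t ∈ lifespan T, mc μ ρ (θ t) = logCenter μ ρ (y t)) ∧
      (∀ t ∈ lifespan T, mH μ (θ t) = logCeiling μ (y t)) ∧
      ∀ t ∈ lifespan T, ∀ j, beta (θ t) j = Real.exp (2 * y t j) := by
  obtain ⟨y, hy, hθ⟩ := h.exists_isMaximalSolution h0 hμ hρ hα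
  exact ⟨y, hy, fun t ht => by rw [hθ t ht, mc_expParam],
    fun t ht => by rw [hθ t ht, mH_expParam h0 hμ],
    fun t ht j => by rw [hθ t ht, beta_expParam]⟩

theorem IsMaximalFlow.below_floor (h0 : 0 < μ 0) (hμ : StrictMono μ) (hρ : 0 < ρ) (hα : 0 < α)
    (hlt : α < alpha0 μ ρ) (h : IsMaximalFlow μ ρ α T θ) :
    (∀ t ∈ lifespan T, mc μ ρ (θ t) < mL μ) ∧
      StrictAntiOn (fun t => mc μ ρ (θ t)) (lifespan T) ∧
      ∀ j, ExpDecayOn (fun t => beta (θ t) j) (lifespan T) := by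
  obtain ⟨y, hy, hm, -, hβ⟩ := h.exists_logCoordinates h0 hμ hρ hα
  have hstart : logCenter μ ρ (y 0) < mL μ := by
    rw [hy.start]; exact (lt_alpha0_iff h0 hμ hρ hα).1 hlt
  have hzero := zero_mem_lifespan hy.pos
  have hfloor : ∀ t ∈ lifespan T, logCenter μ ρ (y t) < mL μ := fun t ht =>
    (eq_or_lt_of_le ht.1).elim (fun e => e ▸ hstart)
      fun hl => hy.sol.center_lt_floor h0 hμ hρ le_rfl hstart.le ht hl
  refine ⟨fun t ht => hm t ht ▸ hfloor t ht, ?_, fun j => ?_⟩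
  · exact (hy.sol.strictAntiOn_logCenter h0 hμ hρ (convex_lifespan T) subset_rfl fun t ht =>
      (hfloor t (interior_subset ht)).trans (floor_lt_logCeiling h0 hμ _)).congr
        fun t ht => (hm t ht).symm
  · have hd := hy.sol.expDecayOn h0 hμ hρ hzero hstart j
    rw [inter_eq_left.2 (lifespan_subset_Ici T)] at hd
    exact hd.congr fun t ht => hβ t ht j

theorem IsMaximalFlow.trapped (h0 : 0 < μ 0) (hμ : StrictMono μ) (hρ : 0 < ρ) (hα : 0 < α)
    (hF : ¬FallsBelowFloor μ ρ α) (hC : ¬RisesAboveCeiling μ ρ α)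
    (h : IsMaximalFlow μ ρ α T θ) :
    T = ⊤ ∧ ∀ t : ℝ, 0 ≤ t → mL μ < mc μ ρ (θ t) ∧ mc μ ρ (θ t) < mH μ (θ t) := by
  obtain ⟨y, hy, hm, hH, -⟩ := h.exists_logCoordinates h0 hμ hρ hα
  obtain rfl := hy.eq_top_of_not_fallsBelowFloor h0 hμ hρ hF
  refine ⟨rfl, fun t ht => ?_⟩
  rw [← mem_lifespan_top] at ht
  rw [hm t ht, hH t ht]
  exact hy.trapped h0 hμ hρ hF hC ht

theorem IsMaximalFlow.neither_of_trapped (h0 : 0 < μ 0) (hμ : StrictMono μ) (hρ : 0 < ρ)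
    (hα : 0 < α) (h : IsMaximalFlow μ ρ α T θ)
    (htr : ∀ t ∈ lifespan T, mL μ < mc μ ρ (θ t) ∧ mc μ ρ (θ t) < mH μ (θ t)) :
    ¬FallsBelowFloor μ ρ α ∧ ¬RisesAboveCeiling μ ρ α := by
  obtain ⟨y, hy, hm, hH, -⟩ := h.exists_logCoordinates h0 hμ hρ hα
  refine ⟨fun hF => ?_, fun hC => ?_⟩
  · obtain ⟨t, ht, hlt⟩ := hF.exists_lt h0 hμ hρ hy
    exact lt_asymm hlt (hm t ht ▸ (htr t ht).1)
  · obtain ⟨t, ht, hlt⟩ := hC.exists_lt h0 hμ hρ hy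
    exact lt_asymm hlt (hm t ht ▸ hH t ht ▸ (htr t ht).2)

theorem IsMaximalFlow.floor_first (h0 : 0 < μ 0) (hμ : StrictMono μ) (hρ : 0 < ρ)
    (hle : alpha0 μ ρ ≤ α) (hF : FallsBelowFloor μ ρ α) (h : IsMaximalFlow μ ρ α T θ) :
    tauF μ ρ T θ < tauG μ ρ T θ ∧ StrictAntiOn (fun t => mc μ ρ (θ t)) (lifespan T) ∧
      ∃ tF ∈ lifespan T, tauF μ ρ T θ = (tF : EReal) ∧ ∀ t₀ ∈ lifespan T, tF < t₀ →
        mc μ ρ (θ t₀) < mL μ ∧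
        ∀ j, ExpDecayOn (fun t => beta (θ t) j) (lifespan T ∩ Ici t₀) := by
  have hα := (alpha0_pos h0 hμ hρ).trans_le hle
  obtain ⟨y, hy, hm, hH, hβ⟩ := h.exists_logCoordinates h0 hμ hρ hα
  obtain ⟨t₁, ht₁, hlt₁⟩ := hF.exists_lt h0 hμ hρ hy
  have hceil : ∀ t ∈ lifespan T, logCenter μ ρ (y t) < logCeiling μ (y t) := fun t ht =>
    hy.sol.center_lt_ceiling_of_lt_floor h0 hμ hρ ht₁ hlt₁ ht
  have hanti := hy.sol.strictAntiOn_logCenter h0 hμ hρ (convex_lifespan T) subset_rfl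
    fun t ht => hceil t (interior_subset ht)
  have hstart : mL μ ≤ logCenter μ ρ (y 0) := by
    rw [hy.start]
    exact not_lt.1 fun hc => hle.not_gt ((lt_alpha0_iff h0 hμ hρ hα).2 hc)
  obtain ⟨tF, htF, heq⟩ : mL μ ∈ (fun t => logCenter μ ρ (y t)) '' Icc 0 t₁ :=
    intermediate_value_Icc' ht₁.1 ((hy.sol.continuousOn_logCenter h0 hμ).mono
      fun s hs => mem_lifespan_of_le hs.1 hs.2 ht₁) ⟨hlt₁.le, hstart⟩
  have htF' : tF ∈ lifespan T := mem_lifespan_of_le htF.1 htF.2 ht₁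
  have hτF : tauF μ ρ T θ = (tF : EReal) := by
    refine hittingTime_eq_coe htF' ((hm tF htF').trans heq) fun t ht hPt => ?_
    rw [hm t ht] at hPt
    exact (hanti.injOn htF' ht (heq.trans hPt.symm)).le
  -- A trajectory that falls below the floor is below the ceiling at all times, before and after, so
  -- the ceiling is never hit.
  have hτG : tauG μ ρ T θ = ⊤ := hittingTime_eq_top fun t ht hPt => by
    rw [hm t ht, hH t ht] at hPt
    linarith [hceil t ht]
  refine ⟨by rw [hτF, hτG]; exact EReal.coe_lt_top _, hanti.congr fun t ht => (hm t ht).symm,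
    tF, htF', hτF, fun t₀ ht₀ hlt => ?_⟩
  have hlt₀ := hy.sol.center_lt_floor h0 hμ hρ htF.1 (le_of_eq heq) ht₀ hlt
  exact ⟨hm t₀ ht₀ ▸ hlt₀, fun j => (hy.sol.expDecayOn h0 hμ hρ ht₀ hlt₀ j).congr
    fun t ht => hβ t ht.1 j⟩

theorem IsMaximalFlow.ceiling_first (h0 : 0 < μ 0) (hμ : StrictMono μ) (hρ : 0 < ρ) (hα : 0 < α)
    (hle : α ≤ alphaH μ ρ) (hC : RisesAboveCeiling μ ρ α) (h : IsMaximalFlow μ ρ α T θ) :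
    T = ⊤ ∧ tauG μ ρ T θ < tauF μ ρ T θ ∧
      ∃ tG : ℝ, 0 ≤ tG ∧ tauG μ ρ T θ = (tG : EReal) ∧
        StrictAntiOn (fun t => mc μ ρ (θ t)) (Icc 0 tG) ∧
        StrictMonoOn (fun t => mc μ ρ (θ t)) (Ici tG) ∧
        ∀ t : ℝ, tG < t → mH μ (θ t) < mc μ ρ (θ t) := by
  obtain ⟨y, hy, hm, hH, -⟩ := h.exists_logCoordinates h0 hμ hρ hα
  obtain rfl := hy.eq_top_of_not_fallsBelowFloor h0 hμ hρ
    fun hF => hF.not_risesAboveCeiling h0 hμ hρ hC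
  obtain ⟨t₁, ht₁, hlt₁⟩ := hC.exists_lt h0 hμ hρ hy
  have hstart : logCenter μ ρ (y 0) - logCeiling μ (y 0) ≤ 0 := by
    rw [hy.start, sub_nonpos]
    exact not_lt.1 fun hc => hle.not_gt ((alphaH_lt_iff h0 hμ hρ hα).2 hc)
  have hcont : ContinuousOn (fun t => logCenter μ ρ (y t) - logCeiling μ (y t)) (lifespan ⊤) :=
    (hy.sol.continuousOn_logCenter h0 hμ).sub
      ((continuous_logCeiling h0 hμ).comp_continuousOn hy.sol.continuousOn)
  obtain ⟨tG, htG, heq⟩ :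
      (0 : ℝ) ∈ (fun t => logCenter μ ρ (y t) - logCeiling μ (y t)) '' Icc 0 t₁ :=
    intermediate_value_Icc ht₁.1 (hcont.mono fun s hs => mem_lifespan_of_le hs.1 hs.2 ht₁)
      ⟨hstart, (sub_pos.2 hlt₁).le⟩
  have htG' : tG ∈ lifespan ⊤ := mem_lifespan_top.2 htG.1
  have heq' : logCenter μ ρ (y tG) = logCeiling μ (y tG) := sub_eq_zero.1 heq
  have hbefore : ∀ t, 0 ≤ t → t < tG → logCenter μ ρ (y t) < logCeiling μ (y t) := by
    intro t ht hlt
    by_contra! hge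
    exact (hy.sol.ceiling_lt_center h0 hμ hρ ht hge htG' hlt).ne' heq'
  have hafter : ∀ t, tG < t → logCeiling μ (y t) < logCenter μ ρ (y t) := fun t hlt =>
    hy.sol.ceiling_lt_center h0 hμ hρ htG.1 heq'.ge
      (mem_lifespan_top.2 (htG.1.trans hlt.le)) hlt
  have hτG : tauG μ ρ ⊤ θ = (tG : EReal) := by
    refine hittingTime_eq_coe htG' (by rw [hm _ htG', hH _ htG']; exact heq) fun t ht hPt => ?_
    rw [hm t ht, hH t ht] at hPt
    by_contra! hlt
    linarith [hbefore t ht.1 hlt]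
  -- Touching the ceiling at any time excludes touching the floor at every time, so the floor
  -- hitting time is infinite.
  have hτF : tauF μ ρ ⊤ θ = ⊤ := hittingTime_eq_top fun t ht hPt => by
    rw [hm t ht] at hPt
    exact (hy.sol.floor_lt_center_of_ceiling_le h0 hμ hρ htG' heq'.ge ht).ne' hPt
  have hsub : Ici tG ⊆ lifespan ⊤ := fun t ht => mem_lifespan_top.2 (htG.1.trans ht)
  have hsub' : Icc 0 tG ⊆ lifespan ⊤ := fun t ht => mem_lifespan_top.2 ht.1
  refine ⟨rfl, by rw [hτF, hτG]; exact EReal.coe_lt_top _, tG, htG.1, hτG, ?_, ?_,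
    fun t hlt => ?_⟩
  · refine (hy.sol.strictAntiOn_logCenter h0 hμ hρ (convex_Icc 0 tG) hsub' fun t ht => ?_).congr
      fun t ht => (hm t (hsub' ht)).symm
    rw [interior_Icc] at ht
    exact hbefore t ht.1.le ht.2
  · refine (hy.sol.strictMonoOn_logCenter h0 hμ hρ (convex_Ici tG) hsub fun t ht => ?_).congr
      fun t ht => (hm t (hsub ht)).symm
    rw [interior_Ici] at ht
    exact hafter t ht
  · rw [hm t (hsub hlt.le), hH t (hsub hlt.le)]
    exact hafter t hlt

theorem IsMaximalFlow.above_ceiling (h0 : 0 < μ 0) (hμ : StrictMono μ) (hρ : 0 < ρ)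
    (hlt : alphaH μ ρ < α) (h : IsMaximalFlow μ ρ α T θ) :
    T = ⊤ ∧ (∀ t : ℝ, 0 ≤ t → mH μ (θ t) < mc μ ρ (θ t)) ∧
      StrictMonoOn (fun t => mc μ ρ (θ t)) (Ici 0) := by
  have hα := (alphaH_pos h0 hμ hρ).trans hlt
  obtain ⟨y, hy, hm, hH, -⟩ := h.exists_logCoordinates h0 hμ hρ hα
  obtain rfl := hy.eq_top_of_not_fallsBelowFloor h0 hμ hρ fun hF =>
    hF.not_risesAboveCeiling h0 hμ hρ (risesAboveCeiling_of_alphaH_le h0 hμ hρ hlt.le)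
  have hstart : logCeiling μ (y 0) < logCenter μ ρ (y 0) := by
    rw [hy.start]; exact (alphaH_lt_iff h0 hμ hρ hα).1 hlt
  have habove : ∀ t, 0 ≤ t → logCeiling μ (y t) < logCenter μ ρ (y t) := fun t ht =>
    (eq_or_lt_of_le ht).elim (fun e => e ▸ hstart)
      fun hl => hy.sol.ceiling_lt_center h0 hμ hρ le_rfl hstart.le (mem_lifespan_top.2 ht) hl
  have hsub : Ici (0 : ℝ) ⊆ lifespan ⊤ := fun t ht => mem_lifespan_top.2 ht
  refine ⟨rfl, fun t ht => ?_, ?_⟩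
  · rw [hm t (hsub ht), hH t (hsub ht)]
    exact habove t ht
  · exact (hy.sol.strictMonoOn_logCenter h0 hμ hρ (convex_Ici 0) hsub fun t ht =>
      habove t (interior_subset ht)).congr fun t ht => (hm t (hsub ht)).symm

theorem IsMaximalFlow.top_threshold (h0 : 0 < μ 0) (hμ : StrictMono μ) (hρ : 0 < ρ) (hα : 0 < α)
    (h : IsMaximalFlow μ ρ α T θ) :
    (α < alpha2 μ ρ ↔ mc μ ρ (θ 0) < mTop μ) ∧ (alpha2 μ ρ < α ↔ mTop μ < mc μ ρ (θ 0)) ∧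
      (alpha2 μ ρ < α → ∀ t : ℝ, 0 ≤ t → mTop μ < mc μ ρ (θ t)) := by
  obtain ⟨y, hy, hm, -, -⟩ := h.exists_logCoordinates h0 hμ hρ hα
  have hm0 : mc μ ρ (θ 0) = logCenter μ ρ (fun _ => Real.log α) := by
    rw [hm 0 (zero_mem_lifespan hy.pos), hy.start]
  have hiff : alpha2 μ ρ < α ↔ mTop μ < mc μ ρ (θ 0) := by
    rw [hm0]; exact alpha2_lt_iff h0 hμ hρ hα
  refine ⟨by rw [hm0]; exact lt_alpha2_iff h0 hμ hρ hα, hiff, fun hlt t ht => ?_⟩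
  -- Since α_H < α₂ < α, the center is increasing, so its initial position above the midpoint
  -- persists.
  obtain ⟨-, -, hmono⟩ := h.above_ceiling h0 hμ hρ ((alphaH_lt_alpha2 h0 hμ hρ).trans hlt)
  exact (hiff.1 hlt).trans_le (hmono.monotoneOn (mem_Ici.2 le_rfl) ht ht)

end Regimes

end SAMFlow

end

theorem mainTheorem1 (k : ℕ) (μ : Fin (k + 2) → ℝ) (hμpos : 0 < μ 0) (hμ : StrictMono μ)
    (ρ : ℝ) (hρ : 0 < ρ) :
    -- every initialization scale has a maximal trajectory
    (∀ α : ℝ, 0 < α → ∃ T θ, SAMFlow.IsMaximalFlow μ ρ α T θ) ∧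
    -- Regime 1-a
    (∀ α : ℝ, 0 < α → α < SAMFlow.alpha0 μ ρ →
      ∀ T θ, SAMFlow.IsMaximalFlow μ ρ α T θ →
        (∀ t ∈ SAMFlow.lifespan T, SAMFlow.mc μ ρ (θ t) < SAMFlow.mL μ) ∧
        StrictAntiOn (fun t => SAMFlow.mc μ ρ (θ t)) (SAMFlow.lifespan T) ∧
        ∀ j, SAMFlow.ExpDecayOn (fun t => SAMFlow.beta (θ t) j) (SAMFlow.lifespan T)) ∧
    -- the boundary scale `α₁`
    (∃ α₁ : ℝ, SAMFlow.alpha0 μ ρ < α₁ ∧ α₁ < SAMFlow.alphaH μ ρ ∧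
      (∀ T θ, SAMFlow.IsMaximalFlow μ ρ α₁ T θ →
        T = ⊤ ∧ ∀ t : ℝ, 0 ≤ t →
          SAMFlow.mL μ < SAMFlow.mc μ ρ (θ t) ∧ SAMFlow.mc μ ρ (θ t) < SAMFlow.mH μ (θ t)) ∧
      (∀ α : ℝ, 0 < α → ∀ T θ, SAMFlow.IsMaximalFlow μ ρ α T θ →
        (∀ t ∈ SAMFlow.lifespan T,
          SAMFlow.mL μ < SAMFlow.mc μ ρ (θ t) ∧ SAMFlow.mc μ ρ (θ t) < SAMFlow.mH μ (θ t)) →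
        α = α₁) ∧
      -- Regime 1-b: floor first
      (∀ α : ℝ, SAMFlow.alpha0 μ ρ ≤ α → α < α₁ →
        ∀ T θ, SAMFlow.IsMaximalFlow μ ρ α T θ →
          SAMFlow.tauF μ ρ T θ < SAMFlow.tauG μ ρ T θ ∧
          StrictAntiOn (fun t => SAMFlow.mc μ ρ (θ t)) (SAMFlow.lifespan T) ∧
          ∃ tF ∈ SAMFlow.lifespan T, SAMFlow.tauF μ ρ T θ = (tF : EReal) ∧
            ∀ t₀ ∈ SAMFlow.lifespan T, tF < t₀ →
              SAMFlow.mc μ ρ (θ t₀) < SAMFlow.mL μ ∧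
              ∀ j, SAMFlow.ExpDecayOn (fun t => SAMFlow.beta (θ t) j)
                (SAMFlow.lifespan T ∩ Set.Ici t₀)) ∧
      -- Regime 2-a: ceiling first
      (∀ α : ℝ, α₁ < α → α ≤ SAMFlow.alphaH μ ρ →
        ∀ T θ, SAMFlow.IsMaximalFlow μ ρ α T θ →
          T = ⊤ ∧
          SAMFlow.tauG μ ρ T θ < SAMFlow.tauF μ ρ T θ ∧
          ∃ tG : ℝ, 0 ≤ tG ∧ SAMFlow.tauG μ ρ T θ = (tG : EReal) ∧
            StrictAntiOn (fun t => SAMFlow.mc μ ρ (θ t)) (Set.Icc 0 tG) ∧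
            StrictMonoOn (fun t => SAMFlow.mc μ ρ (θ t)) (Set.Ici tG) ∧
            ∀ t : ℝ, tG < t → SAMFlow.mH μ (θ t) < SAMFlow.mc μ ρ (θ t))) ∧
    -- Regimes 2-b and 3
    (∀ α : ℝ, SAMFlow.alphaH μ ρ < α →
      ∀ T θ, SAMFlow.IsMaximalFlow μ ρ α T θ →
        T = ⊤ ∧
        (∀ t : ℝ, 0 ≤ t → SAMFlow.mH μ (θ t) < SAMFlow.mc μ ρ (θ t)) ∧
        StrictMonoOn (fun t => SAMFlow.mc μ ρ (θ t)) (Set.Ici 0)) ∧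
    -- the threshold `α₂` between Regimes 2 and 3
    SAMFlow.alphaH μ ρ < SAMFlow.alpha2 μ ρ ∧
    (∀ α : ℝ, 0 < α → ∀ T θ, SAMFlow.IsMaximalFlow μ ρ α T θ →
      (α < SAMFlow.alpha2 μ ρ ↔ SAMFlow.mc μ ρ (θ 0) < SAMFlow.mTop μ) ∧
      (SAMFlow.alpha2 μ ρ < α ↔ SAMFlow.mTop μ < SAMFlow.mc μ ρ (θ 0)) ∧
      (SAMFlow.alpha2 μ ρ < α →
        ∀ t : ℝ, 0 ≤ t → SAMFlow.mTop μ < SAMFlow.mc μ ρ (θ t))) := by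
  obtain ⟨α₁, h01, h1H, hF, hC, huniq, hbelow, habove⟩ :=
    SAMFlow.exists_boundary_scale hμpos hμ hρ
  have hα₁ : 0 < α₁ := (SAMFlow.alpha0_pos hμpos hμ hρ).trans h01
  refine ⟨fun α hα => SAMFlow.exists_isMaximalFlow hμpos hμ hρ hα,
    fun α hα hlt T θ h => h.below_floor hμpos hμ hρ hα hlt,
    ⟨α₁, h01, h1H, fun T θ h => h.trapped hμpos hμ hρ hα₁ hF hC, fun α hα T θ h htr => ?_,
      fun α hle hlt T θ h => ?_, fun α hlt hle T θ h => ?_⟩,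
    fun α hlt T θ h => h.above_ceiling hμpos hμ hρ hlt,
    SAMFlow.alphaH_lt_alpha2 hμpos hμ hρ,
    fun α hα T θ h => h.top_threshold hμpos hμ hρ hα⟩
  · obtain ⟨hf, hc⟩ := h.neither_of_trapped hμpos hμ hρ hα htr
    exact huniq α hα hf hc
  · exact h.floor_first hμpos hμ hρ hle
      (hbelow α ((SAMFlow.alpha0_pos hμpos hμ hρ).trans_le hle) hlt)
  · exact h.ceiling_first hμpos hμ hρ (hα₁.trans hlt) hle (habove α hlt)
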